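/- Let $\delta\ge 1$ be an integer, $\tau=\tau_1+i\tau_2\in\mathbb C$ with $\tau_2>0$, $V=\mathbb C$, $\Lambda=\mathbb Z\delta+\mathbb Z\tau$, $M=V/\Lambda$, and let $dx_1,dx_2$ be the real linear forms on $V$ dual to the basis $\delta,\tau$. *The dual torus and the Poincaré line bundle.* Let $e_1^*=-\frac{i}{2\tau_2}\,d\bar z$, let $\overline V^{*}=\{\hat\mu\, e_1^*:\hat\mu\in\mathbb C\}$ be the space of conjugate linear forms on $V$, and let $\overline\Lambda^{*}=\mathbb Z e_1^*+\mathbb Z\frac{\tau}{\delta}e_1^*$, which is the lattice of the conjugate linear parts of the forms in $\Lambda^*=\mathbb Z\,dx_1+\mathbb Z\,dx_2$. Put $\widehat M=\overline V^{*}/\overline\Lambda^{*}=\mathrm{Pic}^0(M)$; the point $[\hat\mu]$ corresponds to the holomorphic line bundle $\mathrm P_{\hat\mu}\to M$ with the constant multipliers $e_\lambda=\exp\big(2\pi i\,\hat\mu\, e_1^*(\lambda)\big)$, $\lambda\in\Lambda$ (its sections are the functions $\theta$ on $V$ with $\theta(z+\lambda)=e_\lambda\,\theta(z)$). A *Poincaré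 line bundle* is a holomorphic line bundle $\mathrm P\to M\times\widehat M$ such that $\mathrm P|_{M\times\{[\hat\mu]\}}\cong \mathrm P_{\hat\mu}$ for every $\hat\mu$, and $\mathrm P|_{\{0\}\times\widehat M}$ is holomorphically trivial. *The gauge-theoretic line bundle.* Let $V^*=\mathrm{Hom}_{\mathbb R}(V,\mathbb R)$ and $M^*=V^*/2\pi\Lambda^*$. Let $\mathcal P\to M\times M^*$ be the quotient of the trivial complex line bundle over $M\times V^*$ by the action of $2\pi\Lambda^*$ given by $$2\pi\nu\circ(x,\xi,\sigma)=\big(x,\ \xi+2\pi\nu,\ e^{-2\pi i\langle\nu,x\rangle}\sigma\big),\qquad \nu\in\Lambda^*,$$ with the connection induced by $d+i\xi$, where $i\xi$ is the one-form $(w,\eta)\mapsto i\,\xi(w)$ at $(x,\xi)$. Let $Iso:\widehat M\to M^*$ be the group isomorphism induced by $\hat\mu\,e_1^*\mapsto \xi_1dx_1+\xi_2dx_2$ with $$\xi_1=\tfrac{2\pi\delta}{\tau_2}\hat\mu_2,\qquad \xi_2=\tfrac{2\pi}{\tau_2}\big(\tau_1\hat\mu_2-\tau_2\hat\mu_1\big),\qquad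 \hat\mu=\hat\mu_1+i\hat\mu_2,$$ and let $\widetilde{Iso}=(Id,Iso):M\times\widehat M\to M\times M^*$. Then $\widetilde{Iso}^*\mathcal P$ is a holomorphic line bundle, whose local holomorphic sections are the smooth sections annihilated by the $(0,1)$-part of the pulled back connection. **Theorem.** $\widetilde{Iso}^*\mathcal P$ is a Poincaré line bundle, and every Poincaré line bundle $\mathrm P\to M\times\widehat M$ is isomorphic to it as a holomorphic line bundle: $$\mathrm P\cong\widetilde{Iso}^*\mathcal P .$$ -/

import Mathlib

open scoped Manifold ContDiff Topology Bundle UpperHalfPlane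
open Bundle

noncomputable section

namespace CTorus

section Quotient

variable {W : Type*} [NormedAddCommGroup W]

theorem isLocalHomeomorph_mk (Γ : AddSubgroup W) [DiscreteTopology Γ] :
    IsLocalHomeomorph (QuotientAddGroup.mk : W → W ⧸ Γ) :=
  (AddSubgroup.isAddQuotientCoveringMap_of_comm Γ ⟨inferInstance⟩).isCoveringMap.isLocalHomeomorph

/-- The manifold structure of `W ⧸ Γ` for a discrete subgroup `Γ`: the charts are the local
inverses of the projection `W → W ⧸ Γ`. -/
instance chartedSpaceQuotient (Γ : AddSubgroup W) [DiscreteTopology Γ] :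
    ChartedSpace W (W ⧸ Γ) where
  atlas := Set.range fun w : W => (isLocalHomeomorph_mk Γ).localInverseAt (x := w)
  chartAt q := (isLocalHomeomorph_mk Γ).localInverseAt (x := Quotient.out q)
  mem_chart_source q := by
    have h := (isLocalHomeomorph_mk Γ).apply_self_mem_localInverseAt_source (x := Quotient.out q)
    rwa [QuotientAddGroup.out_eq'] at h
  chart_mem_atlas q := ⟨_, rfl⟩

theorem mk_chart {Γ : AddSubgroup W} [DiscreteTopology Γ]
    {e : OpenPartialHomeomorph (W ⧸ Γ) W} (he : e ∈ atlas W (W ⧸ Γ)) {q : W ⧸ Γ}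
    (hq : q ∈ e.source) : QuotientAddGroup.mk (e q) = q := by
  obtain ⟨w, rfl⟩ := he
  exact (isLocalHomeomorph_mk Γ).apply_localInverseAt_of_mem hq

theorem chart_symm {Γ : AddSubgroup W} [DiscreteTopology Γ]
    {e : OpenPartialHomeomorph (W ⧸ Γ) W} (he : e ∈ atlas W (W ⧸ Γ)) (w : W) :
    e.symm w = QuotientAddGroup.mk w := by
  obtain ⟨w', rfl⟩ := he
  exact congrFun ((isLocalHomeomorph_mk Γ).localInverseAt_symm w') w

/-- A continuous map that moves points by elements of a discrete subgroup is locally a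
translation. -/
theorem eventually_translation (Γ : AddSubgroup W) [DiscreteTopology Γ] {X : Type*}
    [TopologicalSpace X] {x₀ : X} {f g : X → W} (hf : ContinuousAt f x₀) (hg : ContinuousAt g x₀)
    (h : ∀ᶠ x in 𝓝 x₀, f x - g x ∈ Γ) : ∀ᶠ x in 𝓝 x₀, f x = g x + (f x₀ - g x₀) := by
  have h₀ : f x₀ - g x₀ ∈ Γ := h.self_of_nhds
  obtain ⟨V, hV, hVe⟩ : ∃ V ∈ 𝓝 (f x₀ - g x₀), V ∩ Γ ⊆ {f x₀ - g x₀} := by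
    have := (isOpen_discrete ({⟨_, h₀⟩} : Set Γ))
    obtain ⟨V, hV, hVe⟩ := isOpen_induced_iff.1 this
    refine ⟨V, hV.mem_nhds ?_, ?_⟩
    · have : (⟨_, h₀⟩ : Γ) ∈ Subtype.val ⁻¹' V := by rw [hVe]; rfl
      exact this
    · rintro y ⟨hy, hyΓ⟩
      have : (⟨y, hyΓ⟩ : Γ) ∈ Subtype.val ⁻¹' V := hy
      rw [hVe] at this
      exact congrArg Subtype.val this
  filter_upwards [h, (hf.sub hg).preimage_mem_nhds hV] with x hx hxV
  have := hVe ⟨hxV, hx⟩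
  rw [Set.mem_singleton_iff] at this
  rw [← this, Pi.sub_apply, add_sub_cancel]

instance isManifoldQuotient {𝕜 : Type*} [NontriviallyNormedField 𝕜] [NormedSpace 𝕜 W]
    (n : WithTop ℕ∞) (Γ : AddSubgroup W) [DiscreteTopology Γ] : IsManifold 𝓘(𝕜, W) n (W ⧸ Γ) := by
  apply isManifold_of_contDiffOn
  intro e e' he he'
  simp only [modelWithCornersSelf_coe, modelWithCornersSelf_coe_symm, Function.comp_id,
    Function.id_comp, Set.preimage_id, Set.range_id, Set.inter_univ]
  intro w hw
  have ho : (e.symm.trans e').source ∈ 𝓝 w := (e.symm.trans e').open_source.mem_nhds hw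
  have hc : ContinuousAt (e.symm.trans e') w := (e.symm.trans e').continuousAt hw
  have key := eventually_translation Γ hc continuousAt_id (by
    filter_upwards [ho] with x hx
    have h1 := mk_chart he' (q := e.symm x) (by
      rw [OpenPartialHomeomorph.trans_source] at hx
      exact hx.2)
    rw [chart_symm he] at h1
    have h2 := (QuotientAddGroup.eq.1 h1)
    have h3 := Γ.neg_mem h2
    simpa [chart_symm he, sub_eq_add_neg, add_comm] using h3)
  refine ContDiffAt.contDiffWithinAt ?_
  refine ContDiffAt.congr_of_eventuallyEq ?_ key
  exact contDiffAt_id.add contDiffAt_const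

end Quotient

/-- A function on an open subset of a product of two tori is smooth as soon as its lift is. -/
theorem contMDiffOn_of_lift {Γ₁ Γ₂ : AddSubgroup ℂ} [DiscreteTopology Γ₁] [DiscreteTopology Γ₂]
    {F : Type*} [NormedAddCommGroup F] [NormedSpace ℂ F] {n : WithTop ℕ∞}
    {g : (ℂ ⧸ Γ₁) × (ℂ ⧸ Γ₂) → F} {U : Set ((ℂ ⧸ Γ₁) × (ℂ ⧸ Γ₂))} (hU : IsOpen U)
    (h : ContDiffOn ℂ n (fun u : ℂ × ℂ => g (QuotientAddGroup.mk u.1, QuotientAddGroup.mk u.2))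
      {u | ((QuotientAddGroup.mk u.1 : ℂ ⧸ Γ₁), (QuotientAddGroup.mk u.2 : ℂ ⧸ Γ₂)) ∈ U}) :
    ContMDiffOn (𝓘(ℂ, ℂ).prod 𝓘(ℂ, ℂ)) 𝓘(ℂ, F) n g U := by
  have hcont : Continuous fun u : ℂ × ℂ =>
      ((QuotientAddGroup.mk u.1 : ℂ ⧸ Γ₁), (QuotientAddGroup.mk u.2 : ℂ ⧸ Γ₂)) :=
    (QuotientAddGroup.continuous_mk.comp continuous_fst).prodMk
      (QuotientAddGroup.continuous_mk.comp continuous_snd)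
  intro p hp
  apply ContMDiffAt.contMDiffWithinAt
  set c : (ℂ ⧸ Γ₁) × (ℂ ⧸ Γ₂) → ℂ × ℂ := fun q => (chartAt ℂ p.1 q.1, chartAt ℂ p.2 q.2) with hc
  have hmk1 : ∀ q ∈ (chartAt ℂ p.1).source, (QuotientAddGroup.mk (chartAt ℂ p.1 q) : ℂ ⧸ Γ₁) = q :=
    fun q hq => mk_chart (chart_mem_atlas ℂ p.1) hq
  have hmk2 : ∀ q ∈ (chartAt ℂ p.2).source, (QuotientAddGroup.mk (chartAt ℂ p.2 q) : ℂ ⧸ Γ₂) = q :=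
    fun q hq => mk_chart (chart_mem_atlas ℂ p.2) hq
  have hcs : ContMDiffAt (𝓘(ℂ, ℂ).prod 𝓘(ℂ, ℂ)) 𝓘(ℂ, ℂ × ℂ) n c p := by
    apply ContMDiffAt.prodMk_space
    · exact (contMDiffAt_extChartAt (I := 𝓘(ℂ, ℂ)) (x := p.1)).comp p contMDiffAt_fst
    · exact (contMDiffAt_extChartAt (I := 𝓘(ℂ, ℂ)) (x := p.2)).comp p contMDiffAt_snd
  have hg : ContMDiffAt 𝓘(ℂ, ℂ × ℂ) 𝓘(ℂ, F) n
      (fun u : ℂ × ℂ => g (QuotientAddGroup.mk u.1, QuotientAddGroup.mk u.2)) (c p) := by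
    refine (h.contDiffAt ((hU.preimage hcont).mem_nhds ?_)).contMDiffAt
    change (_, _) ∈ U
    rw [hmk1 _ (mem_chart_source ℂ p.1), hmk2 _ (mem_chart_source ℂ p.2)]
    exact hp
  refine (hg.comp p hcs).congr_of_eventuallyEq ?_
  have hs : (chartAt ℂ p.1).source ×ˢ (chartAt ℂ p.2).source ∈ 𝓝 p :=
    prod_mem_nhds ((chartAt ℂ p.1).open_source.mem_nhds (mem_chart_source ℂ p.1))
      ((chartAt ℂ p.2).open_source.mem_nhds (mem_chart_source ℂ p.2))
  filter_upwards [hs] with q hq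
  simp only [Function.comp, hc]
  rw [hmk1 _ hq.1, hmk2 _ hq.2]

theorem fderiv_apply_contDiffOn {s : Set (ℂ × ℂ)} (hs : IsOpen s) {g : ℂ × ℂ → ℂ}
    (hg : ContDiffOn ℝ ∞ g s) (v : ℂ × ℂ) : ContDiffOn ℝ ∞ (fun u => fderiv ℝ g u v) s :=
  (hg.fderiv_of_isOpen hs (by simp)).clm_apply contDiffOn_const

/-- A smooth function of two complex variables whose real derivative is complex linear is complex
smooth. -/
theorem contDiffOn_complex {s : Set (ℂ × ℂ)} (hs : IsOpen s) {g : ℂ × ℂ → ℂ}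
    (hg : ContDiffOn ℝ ∞ g s)
    (hd : ∀ u ∈ s, ∀ w, fderiv ℝ g u (Complex.I • w) = Complex.I • fderiv ℝ g u w) :
    ContDiffOn ℂ ∞ g s := by
  rw [contDiffOn_infty]
  intro n
  induction n generalizing g with
  | zero => exact contDiffOn_zero.2 hg.continuousOn
  | succ n ih =>
    have hder : ∀ u ∈ s, HasFDerivAt g
        ((ContinuousLinearMap.fst ℂ ℂ ℂ).smulRight (fderiv ℝ g u (1, 0)) +
          (ContinuousLinearMap.snd ℂ ℂ ℂ).smulRight (fderiv ℝ g u (0, 1))) u := by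
      intro u hu
      have h1 : HasFDerivAt g (fderiv ℝ g u) u :=
        ((hg.contDiffAt (hs.mem_nhds hu)).differentiableAt (by simp)).hasFDerivAt
      refine hasFDerivAt_of_restrictScalars ℝ h1 ?_
      have hc : ∀ (c : ℂ) (v : ℂ × ℂ), fderiv ℝ g u (c • v) = c • fderiv ℝ g u v := by
        intro c v
        have : c • v = c.re • v + c.im • (Complex.I • v) := by
          rw [← Complex.coe_smul, ← Complex.coe_smul, smul_smul, ← add_smul, Complex.re_add_im]
        rw [this, map_add, map_smul, map_smul, hd u hu, ← Complex.coe_smul, ← Complex.coe_smul,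
          smul_smul, ← add_smul, Complex.re_add_im]
      refine ContinuousLinearMap.ext fun w => ?_
      have hw : w = w.1 • ((1, 0) : ℂ × ℂ) + w.2 • ((0, 1) : ℂ × ℂ) := by ext <;> simp
      conv_rhs => rw [hw, map_add, hc, hc]
      rfl
    push_cast
    rw [contDiffOn_succ_iff_fderiv_of_isOpen hs]
    refine ⟨fun u hu => (hder u hu).differentiableAt.differentiableWithinAt, by simp, ?_⟩
    have hv : ∀ v, ContDiffOn ℂ n (fun u => fderiv ℝ g u v) s := by
      intro v
      refine ih (fderiv_apply_contDiffOn hs hg v) ?_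
      intro u hu w
      have hga := hg.contDiffAt (hs.mem_nhds hu)
      have hdd : DifferentiableAt ℝ (fderiv ℝ g) u :=
        ((hg.fderiv_of_isOpen (m := ∞) hs (by simp)).contDiffAt (hs.mem_nhds hu)).differentiableAt
          (by simp)
      have hsymm : IsSymmSndFDerivAt ℝ g u := hga.isSymmSndFDerivAt (by simpa using (ENat.LEInfty.out : (2 : WithTop ℕ∞) ≤ ∞))
      have happ : ∀ v w, fderiv ℝ (fun u => fderiv ℝ g u v) u w = fderiv ℝ (fderiv ℝ g) u v w := by
        intro v w
        rw [fderiv_clm_apply hdd (differentiableAt_const v)]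
        simp [hsymm.eq w v]
      rw [happ, happ, hsymm.eq v (Complex.I • w), hsymm.eq v w, ← happ, ← happ]
      have : (fun u => fderiv ℝ g u (Complex.I • w)) =ᶠ[𝓝 u]
          (fun u => Complex.I • fderiv ℝ g u w) := by
        filter_upwards [hs.mem_nhds hu] with y hy using hd y hy w
      rw [this.fderiv_eq, fderiv_fun_const_smul]
      · rfl
      · exact hdd.clm_apply (differentiableAt_const w)
    refine ContDiffOn.congr (f := fun u => (ContinuousLinearMap.fst ℂ ℂ ℂ).smulRight (fderiv ℝ g u (1, 0)) +
          (ContinuousLinearMap.snd ℂ ℂ ℂ).smulRight (fderiv ℝ g u (0, 1))) ?_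
      (fun u hu => (hder u hu).fderiv)
    exact (contDiffOn_const.smulRight (hv _)).add (contDiffOn_const.smulRight (hv _))

/-! ### The torus, its dual, and the dual gauge torus -/

section Tori

variable (δ : ℕ+) (τ : ℍ)

/-- The real linear form `dx₁` on `V = ℂ`, with `dx₁(δ) = 1`, `dx₁(τ) = 0`. -/
def dx₁ : ℂ →L[ℝ] ℝ := (δ : ℝ)⁻¹ • (Complex.reCLM - (τ.re / τ.im) • Complex.imCLM)

/-- The real linear form `dx₂` on `V = ℂ`, with `dx₂(δ) = 0`, `dx₂(τ) = 1`. -/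
def dx₂ : ℂ →L[ℝ] ℝ := τ.im⁻¹ • Complex.imCLM

theorem dx₁_δ : dx₁ δ τ (δ : ℂ) = 1 := by
  simp [dx₁]

theorem dx₁_τ : dx₁ δ τ (τ : ℂ) = 0 := by
  have := τ.im_ne_zero
  simp [dx₁, this]

theorem dx₂_δ : dx₂ τ (δ : ℂ) = 0 := by
  simp [dx₂]

theorem dx₂_τ : dx₂ τ (τ : ℂ) = 1 := by
  have := τ.im_ne_zero
  simp [dx₂, this]

theorem eq_coords (z : ℂ) : z = (dx₁ δ τ z : ℂ) * δ + (dx₂ τ z : ℂ) * τ := by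
  have := τ.im_ne_zero
  have h : (δ : ℝ) ≠ 0 := by simp
  apply Complex.ext <;> simp [dx₁, dx₂] <;> field_simp
  ring

/-- The lattice `Λ = ℤ δ + ℤ τ` in `V = ℂ`. -/
def Λ : AddSubgroup ℂ := AddSubgroup.closure {(δ : ℂ), (τ : ℂ)}

/-- The lattice of `M̂` in the coordinate `μ̂`: it is spanned by `1` (that is, `e₁*`) and by
`τ / δ`. -/
def Λhat : AddSubgroup ℂ := AddSubgroup.closure {(1 : ℂ), (τ : ℂ) / δ}

/-- The lattice `2π Λ* = ℤ 2π dx₁ + ℤ 2π dx₂` in `V* = Hom(V, ℝ)`. -/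
def Λstar : AddSubgroup (ℂ →L[ℝ] ℝ) :=
  AddSubgroup.closure {(2 * Real.pi) • dx₁ δ τ, (2 * Real.pi) • dx₂ τ}

theorem discrete_of_coords {W : Type*} [NormedAddCommGroup W] {a b : W} (x y : W →+ ℝ)
    (hx : Continuous x) (hy : Continuous y) (hxa : x a = 1) (hxb : x b = 0) (hya : y a = 0)
    (hyb : y b = 1) (h₀ : ∀ w, x w = 0 → y w = 0 → w = 0) :
    DiscreteTopology (AddSubgroup.closure {a, b}) := by
  have hint : ∀ w ∈ AddSubgroup.closure {a, b}, (∃ m : ℤ, x w = m) ∧ ∃ n : ℤ, y w = n := by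
    intro w hw
    obtain ⟨m, n, rfl⟩ := AddSubgroup.mem_closure_pair.1 hw
    exact ⟨⟨m, by simp [hxa, hxb]⟩, ⟨n, by simp [hya, hyb]⟩⟩
  have key : ∀ w ∈ AddSubgroup.closure {a, b}, |x w| < 1 → |y w| < 1 → w = 0 := by
    intro w hw h1 h2
    obtain ⟨⟨m, hm⟩, ⟨n, hn⟩⟩ := hint w hw
    rw [hm] at h1
    rw [hn] at h2
    have h1' : m = 0 := Int.abs_lt_one_iff.1 (by exact_mod_cast h1)
    have h2' : n = 0 := Int.abs_lt_one_iff.1 (by exact_mod_cast h2)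
    exact h₀ w (by simp [hm, h1']) (by simp [hn, h2'])
  apply discreteTopology_of_isOpen_singleton_zero
  have : ({0} : Set (AddSubgroup.closure {a, b})) =
      Subtype.val ⁻¹' ({w | |x w| < 1} ∩ {w | |y w| < 1}) := by
    ext w
    constructor
    · rintro rfl
      simp
    · rintro ⟨h1, h2⟩
      exact Subtype.ext (key w w.2 h1 h2)
  rw [this]
  exact ((isOpen_lt hx.abs continuous_const).inter
    (isOpen_lt hy.abs continuous_const)).preimage continuous_subtype_val

instance : DiscreteTopology (Λ δ τ) := by
  refine discrete_of_coords (dx₁ δ τ : ℂ →+ ℝ) (dx₂ τ : ℂ →+ ℝ) (dx₁ δ τ).continuous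
    (dx₂ τ).continuous (dx₁_δ δ τ) (dx₁_τ δ τ) (dx₂_δ δ τ) (dx₂_τ τ) ?_
  intro w h1 h2
  change dx₁ δ τ w = 0 at h1
  change dx₂ τ w = 0 at h2
  rw [eq_coords δ τ w, h1, h2]
  simp

instance : DiscreteTopology (Λhat δ τ) := by
  have hδ : (δ : ℂ) ≠ 0 := by simp
  let m : ℂ →+ ℂ := AddMonoidHom.mulLeft (δ : ℂ)
  have hm : Continuous m := continuous_const.mul continuous_id
  have h1 : m 1 = δ := mul_one _
  have h2 : m ((τ : ℂ) / δ) = τ := mul_div_cancel₀ _ hδ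
  refine discrete_of_coords ((dx₁ δ τ : ℂ →+ ℝ).comp m) ((dx₂ τ : ℂ →+ ℝ).comp m)
    ((dx₁ δ τ).continuous.comp hm) ((dx₂ τ).continuous.comp hm) ?_ ?_ ?_ ?_ ?_
  · exact (congrArg (dx₁ δ τ) h1).trans (dx₁_δ δ τ)
  · exact (congrArg (dx₁ δ τ) h2).trans (dx₁_τ δ τ)
  · exact (congrArg (dx₂ τ) h1).trans (dx₂_δ δ τ)
  · exact (congrArg (dx₂ τ) h2).trans (dx₂_τ τ)
  · intro w h1 h2
    change dx₁ δ τ (m w) = 0 at h1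
    change dx₂ τ (m w) = 0 at h2
    have h3 : (δ : ℂ) * w = 0 := by
      change m w = 0
      rw [eq_coords δ τ (m w), h1, h2]
      simp
    exact (mul_eq_zero.1 h3).resolve_left hδ

instance : DiscreteTopology (Λstar δ τ) := by
  have hπ : (2 * Real.pi) ≠ 0 := Real.two_pi_pos.ne'
  have hc : ∀ z : ℂ, Continuous fun ξ : ℂ →L[ℝ] ℝ => (2 * Real.pi)⁻¹ * ξ z := fun z =>
    continuous_const.mul (ContinuousLinearMap.apply ℝ ℝ z).continuous
  let ev (z : ℂ) : (ℂ →L[ℝ] ℝ) →+ ℝ :=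
    { toFun := fun ξ => (2 * Real.pi)⁻¹ * ξ z
      map_zero' := by simp
      map_add' := fun ξ ξ' => by simp [mul_add] }
  refine discrete_of_coords (ev δ) (ev τ) (hc δ) (hc τ) ?_ ?_ ?_ ?_ ?_
  · change (2 * Real.pi)⁻¹ * ((2 * Real.pi) * dx₁ δ τ δ) = 1
    rw [dx₁_δ, mul_one, inv_mul_cancel₀ hπ]
  · change (2 * Real.pi)⁻¹ * ((2 * Real.pi) * dx₂ τ δ) = 0
    rw [dx₂_δ, mul_zero, mul_zero]
  · change (2 * Real.pi)⁻¹ * ((2 * Real.pi) * dx₁ δ τ τ) = 0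
    rw [dx₁_τ, mul_zero, mul_zero]
  · change (2 * Real.pi)⁻¹ * ((2 * Real.pi) * dx₂ τ τ) = 1
    rw [dx₂_τ, mul_one, inv_mul_cancel₀ hπ]
  · intro ξ h1 h2
    change (2 * Real.pi)⁻¹ * ξ δ = 0 at h1
    change (2 * Real.pi)⁻¹ * ξ τ = 0 at h2
    have h1' : ξ δ = 0 := (mul_eq_zero.1 h1).resolve_left (inv_ne_zero hπ)
    have h2' : ξ τ = 0 := (mul_eq_zero.1 h2).resolve_left (inv_ne_zero hπ)
    ext z
    have : z = dx₁ δ τ z • (δ : ℂ) + dx₂ τ z • (τ : ℂ) := by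
      simpa using eq_coords δ τ z
    rw [this, map_add, map_smul, map_smul, h1', h2']
    simp

/-- The complex torus `M = V / Λ`. -/
abbrev M : Type := ℂ ⧸ Λ δ τ

/-- The dual torus `M̂ = Pic⁰(M) = V̄* / Λ̄*`, in the coordinate `μ̂` with respect to `e₁*`. -/
abbrev Mhat : Type := ℂ ⧸ Λhat δ τ

/-- The torus `M* = V* / 2πΛ*` of flat unitary line bundles on `M`. -/
abbrev Mstar : Type := (ℂ →L[ℝ] ℝ) ⧸ Λstar δ τ

/-- The projection `V → M`. -/
abbrev mkM (z : ℂ) : M δ τ := QuotientAddGroup.mk z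

/-- The projection `V̄* → M̂`. -/
abbrev mkMhat (μ : ℂ) : Mhat δ τ := QuotientAddGroup.mk μ

/-- The projection `V* → M*`. -/
abbrev mkMstar (ξ : ℂ →L[ℝ] ℝ) : Mstar δ τ := QuotientAddGroup.mk ξ

/-- The conjugate linear form `e₁* = - dx₂^{0,1} = (-i / 2τ₂) dz̄` on `V`; the point `μ̂` of `V̄*`
is the form `μ̂ e₁*`. -/
def eStar (z : ℂ) : ℂ := -Complex.I / (2 * τ.im) * (starRingEnd ℂ) z

/-- The real linear map `V̄* → V*` under `Iso`: it is `μ̂ ↦ ξ₁ dx₁ + ξ₂ dx₂` with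
`ξ₁ = (2πδ/τ₂) μ̂₂` and `ξ₂ = (2π/τ₂) (τ₁ μ̂₂ - τ₂ μ̂₁)`. -/
def isoLift : ℂ →L[ℝ] (ℂ →L[ℝ] ℝ) :=
  ((2 * Real.pi * δ / τ.im) • Complex.imCLM).smulRight (dx₁ δ τ) +
    ((2 * Real.pi / τ.im) • (τ.re • Complex.imCLM - τ.im • Complex.reCLM)).smulRight (dx₂ τ)

theorem isoLift_apply (μ w : ℂ) :
    isoLift δ τ μ w = 2 * Real.pi / τ.im * (μ.im * w.re - μ.re * w.im) := by
  have := τ.im_ne_zero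
  have h : (δ : ℝ) ≠ 0 := by simp
  simp [isoLift, dx₁, dx₂]
  field_simp
  ring

/-- The form `Iso (μ̂ e₁*)` is `2π` times twice the real part of `μ̂ e₁*`. As `dxⱼ` is twice the
real part of its conjugate linear part, `Iso` sends the conjugate linear part of `dxⱼ` to
`2π dxⱼ`. -/
theorem isoLift_eq (μ w : ℂ) : isoLift δ τ μ w = 2 * Real.pi * (2 * (μ * eStar τ w).re) := by
  have := τ.im_ne_zero
  rw [isoLift_apply]
  simp [eStar, Complex.div_re, Complex.div_im, Complex.normSq]
  field_simp
  ring

theorem isoLift_one : isoLift δ τ 1 = -((2 * Real.pi) • dx₂ τ) := by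
  ext w
  have := τ.im_ne_zero
  simp [isoLift_apply, dx₂]
  field_simp

theorem isoLift_τ : isoLift δ τ ((τ : ℂ) / δ) = (2 * Real.pi) • dx₁ δ τ := by
  ext w
  have := τ.im_ne_zero
  have h : (δ : ℝ) ≠ 0 := by simp
  simp [isoLift_apply, dx₁]
  field_simp

theorem isoLift_mem {μ : ℂ} (hμ : μ ∈ Λhat δ τ) : isoLift δ τ μ ∈ Λstar δ τ := by
  obtain ⟨m, n, rfl⟩ := AddSubgroup.mem_closure_pair.1 hμ
  rw [map_add, map_zsmul, map_zsmul, isoLift_one, isoLift_τ]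
  exact add_mem (zsmul_mem (neg_mem (AddSubgroup.subset_closure (by simp))) _)
    (zsmul_mem (AddSubgroup.subset_closure (by simp)) _)

/-- The group homomorphism `Iso : M̂ → M*`. -/
def Iso : Mhat δ τ →+ Mstar δ τ :=
  QuotientAddGroup.map (Λhat δ τ) (Λstar δ τ) (isoLift δ τ : ℂ →+ (ℂ →L[ℝ] ℝ))
    fun _ hμ => isoLift_mem δ τ hμ

/-- `(Id, Iso) : M × M̂ → M × M*`. -/
def isoTilde (p : M δ τ × Mhat δ τ) : M δ τ × Mstar δ τ := (p.1, Iso δ τ p.2)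

theorem Iso_mk (μ : ℂ) : Iso δ τ (mkMhat δ τ μ) = mkMstar δ τ (isoLift δ τ μ) := rfl

theorem pairing_mem {ν : ℂ →L[ℝ] ℝ} (hν : ν ∈ Λstar δ τ) {l : ℂ} (hl : l ∈ Λ δ τ) :
    ∃ n : ℤ, ν l = n * (2 * Real.pi) := by
  obtain ⟨m, n, rfl⟩ := AddSubgroup.mem_closure_pair.1 hν
  obtain ⟨m', n', rfl⟩ := AddSubgroup.mem_closure_pair.1 hl
  refine ⟨m * m' + n * n', ?_⟩
  have h : ∀ ξ : ℂ →L[ℝ] ℝ, ξ (m' • (δ : ℂ) + n' • (τ : ℂ)) = m' * ξ δ + n' * ξ τ := by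
    intro ξ
    rw [map_add, map_zsmul, map_zsmul]
    simp
  rw [h]
  simp [dx₁_δ, dx₁_τ, dx₂_δ, dx₂_τ]
  ring

/-! ### The gauge-theoretic line bundle -/

/-- The fibre over `p = (x, [ξ])` of the quotient of the trivial line bundle over `M × V*` by the
action `2πν ∘ (x, ξ, σ) = (x, ξ + 2πν, exp(-2πi⟨ν, x⟩) σ)` of `2πΛ*`. A vector of this fibre is an
orbit of the action lying over `p`; an orbit is the graph of a function `f` on the coset `[ξ]` with
`f (ξ + 2πν) = exp(-2πi⟨ν, x⟩) f ξ` (here `2πν = ξ' - ξ`, and `x` may be replaced by any of its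
lifts to `V`). -/
def gaugeSubmodule (p : M δ τ × Mstar δ τ) :
    Submodule ℂ ({ξ : ℂ →L[ℝ] ℝ // mkMstar δ τ ξ = p.2} → ℂ) where
  carrier := {f | ∀ x : ℂ, mkM δ τ x = p.1 → ∀ ξ ξ' : {ξ : ℂ →L[ℝ] ℝ // mkMstar δ τ ξ = p.2},
    f ξ' = Complex.exp (-Complex.I * ((ξ'.1 - ξ.1) x : ℝ)) * f ξ}
  add_mem' hf hg x hx ξ ξ' := by
    rw [Pi.add_apply, hf x hx ξ ξ', hg x hx ξ ξ', Pi.add_apply, mul_add]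
  zero_mem' x _ ξ ξ' := by simp
  smul_mem' c f hf x hx ξ ξ' := by
    rw [Pi.smul_apply, hf x hx ξ ξ', Pi.smul_apply, smul_eq_mul, smul_eq_mul, mul_left_comm]

/-- The complex line bundle `𝒫 → M × M*`, given by its fibres. A section of `𝒫` lifts to an
equivariant function on `V × V*`; it is smooth if this function is, and the connection of `𝒫` acts
on such lifts as `d + iξ`. -/
abbrev Gauge (p : M δ τ × Mstar δ τ) : Type := gaugeSubmodule δ τ p

/-- The connection form `i ξ` on the trivial line bundle over `V × V*` (which descends to
`M × V*`): at the point `(x, ξ)` it is `(w, η) ↦ i ξ(w)`. -/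
def connForm (u : ℂ × (ℂ →L[ℝ] ℝ)) : ℂ × (ℂ →L[ℝ] ℝ) →L[ℝ] ℂ :=
  Complex.I • Complex.ofRealCLM.comp (u.2.comp (ContinuousLinearMap.fst ℝ ℂ (ℂ →L[ℝ] ℝ)))

/-- The map `V × V̄* → V × V*` under `(Id, Iso)`. -/
def isoTildeLift : ℂ × ℂ →L[ℝ] ℂ × (ℂ →L[ℝ] ℝ) :=
  (ContinuousLinearMap.id ℝ ℂ).prodMap (isoLift δ τ)

/-- The pull-back of the connection form `i ξ` to `V × V̄*`. -/
def pullConnForm (u : ℂ × ℂ) : ℂ × ℂ →L[ℝ] ℂ :=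
  (connForm (isoTildeLift δ τ u)).comp (isoTildeLift δ τ)

theorem pullConnForm_apply (u w : ℂ × ℂ) :
    pullConnForm δ τ u w = Complex.I * (isoLift δ τ u.2 w.1 : ℝ) := rfl

/-- The pull-back line bundle `(Id, Iso)^* 𝒫 → M × M̂`. -/
def PullGauge (p : M δ τ × Mhat δ τ) : Type := Gauge δ τ (isoTilde δ τ p)

instance (p : M δ τ × Mhat δ τ) : AddCommGroup (PullGauge δ τ p) :=
  inferInstanceAs (AddCommGroup (Gauge δ τ (isoTilde δ τ p)))

instance (p : M δ τ × Mhat δ τ) : Module ℂ (PullGauge δ τ p) :=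
  inferInstanceAs (Module ℂ (Gauge δ τ (isoTilde δ τ p)))

instance (p : M δ τ × Mhat δ τ) : TopologicalSpace (PullGauge δ τ p) :=
  inferInstanceAs (TopologicalSpace (Gauge δ τ (isoTilde δ τ p)))

instance (p : M δ τ × Mhat δ τ) : IsTopologicalAddGroup (PullGauge δ τ p) :=
  inferInstanceAs (IsTopologicalAddGroup (Gauge δ τ (isoTilde δ τ p)))

instance (p : M δ τ × Mhat δ τ) : ContinuousSMul ℂ (PullGauge δ τ p) :=
  inferInstanceAs (ContinuousSMul ℂ (Gauge δ τ (isoTilde δ τ p)))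

instance (p : M δ τ × Mhat δ τ) : T2Space (PullGauge δ τ p) :=
  inferInstanceAs (T2Space (Gauge δ τ (isoTilde δ τ p)))

/-- The projection `V × V̄* → M × M̂`. -/
abbrev proj (u : ℂ × ℂ) : M δ τ × Mhat δ τ := (mkM δ τ u.1, mkMhat δ τ u.2)

theorem continuous_proj : Continuous (proj δ τ) :=
  (QuotientAddGroup.continuous_mk.comp continuous_fst).prodMk
    (QuotientAddGroup.continuous_mk.comp continuous_snd)

/-- The complex number that represents a vector in the fibre over `(x, [μ̂])` when `[μ̂]` is
represented by `μ̂`, that is, `σ` for the class of `(x, Iso μ̂, σ)`. -/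
def rep (p : M δ τ × Mhat δ τ) (μ : ℂ) (hμ : mkMhat δ τ μ = p.2) (f : PullGauge δ τ p) : ℂ :=
  f.1 ⟨isoLift δ τ μ, by rw [← Iso_mk, hμ]; rfl⟩

/-- The function on `V × V̄*` given by a section of `(Id, Iso)^* 𝒫`: its lift to a section of the
trivial line bundle. -/
def lift (s : ∀ p, PullGauge δ τ p) (u : ℂ × ℂ) : ℂ :=
  rep δ τ (proj δ τ u) u.2 rfl (s (proj δ τ u))

/-- The pulled back connection `d + (Id, Iso)^*(i ξ)` on lifts of sections. -/
def nabla (f : ℂ × ℂ → ℂ) (u : ℂ × ℂ) : ℂ × ℂ →L[ℝ] ℂ :=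
  fderiv ℝ f u + f u • pullConnForm δ τ u

/-- The `(0,1)`-part of a real linear form on `V × V̄* = ℂ × ℂ`. -/
def zeroOnePart (T : ℂ × ℂ →L[ℝ] ℂ) (w : ℂ × ℂ) : ℂ :=
  (T w + Complex.I * T (Complex.I • w)) / 2

/-- `s` is a smooth section of `(Id, Iso)^* 𝒫` over `U` that is annihilated by the `(0,1)`-part of
the connection. -/
def IsHolSection (U : Set (M δ τ × Mhat δ τ)) (s : ∀ p, PullGauge δ τ p) : Prop :=
  ContDiffOn ℝ ∞ (lift δ τ s) (proj δ τ ⁻¹' U) ∧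
    ∀ u ∈ proj δ τ ⁻¹' U, ∀ w, zeroOnePart (nabla δ τ (lift δ τ s) u) w = 0

theorem zeroOnePart_eq_zero {T : ℂ × ℂ →L[ℝ] ℂ} {w : ℂ × ℂ} :
    zeroOnePart T w = 0 ↔ T (Complex.I • w) = Complex.I * T w := by
  have hI := Complex.I_mul_I
  unfold zeroOnePart
  constructor
  · intro h
    linear_combination (-2 * Complex.I) * h + T (Complex.I • w) * hI
  · intro h
    rw [h]
    linear_combination (T w / 2) * hI

variable {δ τ}

theorem gauge_change {p : M δ τ × Mstar δ τ} (f : Gauge δ τ p) {x : ℂ} (hx : mkM δ τ x = p.1)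
    {ξ ξ' : ℂ →L[ℝ] ℝ} (hξ : mkMstar δ τ ξ = p.2) (hξ' : mkMstar δ τ ξ' = p.2) :
    f.1 ⟨ξ', hξ'⟩ = Complex.exp (-Complex.I * ((ξ' - ξ) x : ℝ)) * f.1 ⟨ξ, hξ⟩ :=
  f.2 x hx ⟨ξ, hξ⟩ ⟨ξ', hξ'⟩

theorem exp_pairing {p : M δ τ × Mstar δ τ} {x y : ℂ} (hx : mkM δ τ x = p.1)
    (hy : mkM δ τ y = p.1) {ξ ξ' : ℂ →L[ℝ] ℝ} (hξ : mkMstar δ τ ξ = p.2)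
    (hξ' : mkMstar δ τ ξ' = p.2) :
    Complex.exp (-Complex.I * ((ξ' - ξ) y : ℝ)) = Complex.exp (-Complex.I * ((ξ' - ξ) x : ℝ)) := by
  have h1 : ξ' - ξ ∈ Λstar δ τ := by
    have := QuotientAddGroup.eq.1 (hξ.trans hξ'.symm)
    rwa [neg_add_eq_sub] at this
  have h2 : y - x ∈ Λ δ τ := by
    have := QuotientAddGroup.eq.1 (hx.trans hy.symm)
    rwa [neg_add_eq_sub] at this
  obtain ⟨n, hn⟩ := pairing_mem δ τ h1 h2
  rw [map_sub, sub_eq_iff_eq_add] at hn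
  rw [Complex.exp_eq_exp_iff_exists_int]
  refine ⟨-n, ?_⟩
  rw [hn]
  push_cast
  ring

/-- The vector over `p` represented by `(p.1, ξ₀, c)`. -/
def gaugeVec (p : M δ τ × Mstar δ τ) (ξ₀ : ℂ →L[ℝ] ℝ) (c : ℂ) : Gauge δ τ p :=
  ⟨fun ξ => Complex.exp (-Complex.I * ((ξ.1 - ξ₀) p.1.out : ℝ)) * c, by
    intro x hx ξ ξ'
    rw [← exp_pairing hx (QuotientAddGroup.out_eq' p.1) ξ.2 ξ'.2, ← mul_assoc, ← Complex.exp_add]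
    change Complex.exp _ * c = _
    congr 2
    simp only [sub_apply]
    push_cast
    ring⟩

theorem gaugeVec_self (p : M δ τ × Mstar δ τ) (ξ₀ : ℂ →L[ℝ] ℝ) (h : mkMstar δ τ ξ₀ = p.2) (c : ℂ) :
    (gaugeVec p ξ₀ c).1 ⟨ξ₀, h⟩ = c := by
  simp [gaugeVec]

theorem gaugeVec_eq (p : M δ τ × Mstar δ τ) (ξ₀ : ℂ →L[ℝ] ℝ) (h : mkMstar δ τ ξ₀ = p.2)
    (f : Gauge δ τ p) : gaugeVec p ξ₀ (f.1 ⟨ξ₀, h⟩) = f := by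
  apply Subtype.ext
  funext ξ
  exact (gauge_change f (QuotientAddGroup.out_eq' p.1) h ξ.2).symm

theorem isoTilde_snd {p : M δ τ × Mhat δ τ} {μ : ℂ} (hμ : mkMhat δ τ μ = p.2) :
    mkMstar δ τ (isoLift δ τ μ) = (isoTilde δ τ p).2 := by
  rw [← Iso_mk, hμ]
  rfl

theorem rep_change {p : M δ τ × Mhat δ τ} {x μ μ' : ℂ} (hx : mkM δ τ x = p.1)
    (hμ : mkMhat δ τ μ = p.2) (hμ' : mkMhat δ τ μ' = p.2) (f : PullGauge δ τ p) :
    rep δ τ p μ' hμ' f =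
      Complex.exp (-Complex.I * (isoLift δ τ (μ' - μ) x : ℝ)) * rep δ τ p μ hμ f := by
  rw [map_sub]
  exact gauge_change (p := isoTilde δ τ p) f hx (isoTilde_snd hμ) (isoTilde_snd hμ')

/-- The linear coordinate `rep` on a fibre. -/
def repEquiv (p : M δ τ × Mhat δ τ) (μ : ℂ) (hμ : mkMhat δ τ μ = p.2) :
    PullGauge δ τ p ≃ₗ[ℂ] ℂ where
  toFun := rep δ τ p μ hμ
  map_add' _ _ := rfl
  map_smul' _ _ := rfl
  invFun c := gaugeVec (isoTilde δ τ p) (isoLift δ τ μ) c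
  left_inv f := gaugeVec_eq (isoTilde δ τ p) (isoLift δ τ μ) (isoTilde_snd hμ) f
  right_inv c := gaugeVec_self (isoTilde δ τ p) (isoLift δ τ μ) (isoTilde_snd hμ) c

theorem repEquiv_apply (p : M δ τ × Mhat δ τ) (μ : ℂ) (hμ : mkMhat δ τ μ = p.2)
    (f : PullGauge δ τ p) : repEquiv p μ hμ f = rep δ τ p μ hμ f := rfl

/-- The coordinate on the fibre over `p` given by a fixed choice of representative. -/
def coord (p : M δ τ × Mhat δ τ) : PullGauge δ τ p ≃ₗ[ℂ] ℂ :=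
  repEquiv p p.2.out (QuotientAddGroup.out_eq' p.2)

theorem coord_div (s s' : ∀ p, PullGauge δ τ p) (u : ℂ × ℂ) :
    coord (proj δ τ u) (s (proj δ τ u)) / coord (proj δ τ u) (s' (proj δ τ u)) =
      lift δ τ s u / lift δ τ s' u := by
  have h := fun f => rep_change (p := proj δ τ u) (x := u.1) (μ := u.2) rfl rfl
    (QuotientAddGroup.out_eq' _) f
  unfold coord
  rw [repEquiv_apply, repEquiv_apply, h, h, mul_div_mul_left _ _ (Complex.exp_ne_zero _)]
  rfl

theorem lift_ne_zero {s : ∀ p, PullGauge δ τ p} {u : ℂ × ℂ} (h : s (proj δ τ u) ≠ 0) :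
    lift δ τ s u ≠ 0 := fun h' =>
  h ((repEquiv (proj δ τ u) u.2 rfl).map_eq_zero_iff.1 h')

/-- The quotient of two holomorphic sections is a holomorphic function. -/
theorem contDiffOn_div {U : Set (M δ τ × Mhat δ τ)} (hU : IsOpen U) {s s' : ∀ p, PullGauge δ τ p}
    (hs : IsHolSection δ τ U s) (hs' : IsHolSection δ τ U s') (h0 : ∀ p ∈ U, s' p ≠ 0) :
    ContDiffOn ℂ ∞ (fun u => lift δ τ s u / lift δ τ s' u) (proj δ τ ⁻¹' U) := by
  have hO : IsOpen (proj δ τ ⁻¹' U) := hU.preimage (continuous_proj δ τ)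
  have hne : ∀ u ∈ proj δ τ ⁻¹' U, lift δ τ s' u ≠ 0 := fun u hu => lift_ne_zero (h0 _ hu)
  simp only [div_eq_mul_inv]
  refine contDiffOn_complex hO (hs.1.mul (hs'.1.inv hne)) ?_
  intro u hu w
  have hd := ((hs.1.contDiffAt (hO.mem_nhds hu)).differentiableAt (by simp)).hasFDerivAt
  have hd' := ((hs'.1.contDiffAt (hO.mem_nhds hu)).differentiableAt (by simp)).hasFDerivAt
  have h1 := zeroOnePart_eq_zero.1 (hs.2 u hu w)
  have h2 := zeroOnePart_eq_zero.1 (hs'.2 u hu w)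
  have hq : HasFDerivAt (fun u => lift δ τ s u * (lift δ τ s' u)⁻¹) _ u :=
    hd.mul (((hasDerivAt_inv (hne u hu)).complexToReal_fderiv).comp u hd')
  rw [hq.fderiv]
  simp only [nabla, add_apply, smul_apply, smul_eq_mul] at h1 h2 ⊢
  have h0' := hne u hu
  simp only [ContinuousLinearMap.comp_apply, smul_apply, one_apply_eq_self,
    smul_eq_mul]
  field_simp
  linear_combination (lift δ τ s' u) * h1 - (lift δ τ s u) * h2

/-! ### The holomorphic structure on the pull-back -/

/-- The local trivialization given by a frame `s` over `U`. -/
def framePretrivialization (U : Set (M δ τ × Mhat δ τ)) (hU : IsOpen U)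
    (s : ∀ p, PullGauge δ τ p) (h0 : ∀ p ∈ U, s p ≠ 0) :
    Pretrivialization ℂ (π ℂ (PullGauge δ τ)) where
  toFun v := (v.1, coord v.1 v.2 / coord v.1 (s v.1))
  invFun q := ⟨q.1, q.2 • s q.1⟩
  source := π ℂ (PullGauge δ τ) ⁻¹' U
  target := U ×ˢ Set.univ
  map_source' v hv := ⟨hv, trivial⟩
  map_target' q hq := hq.1
  left_inv' := by
    rintro ⟨p, f⟩ hp
    have : coord p (s p) ≠ 0 := fun h => h0 p hp ((coord p).map_eq_zero_iff.1 h)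
    congr 1
    apply (coord p).injective
    simp [this]
  right_inv' := by
    rintro ⟨p, c⟩ ⟨hp, -⟩
    have : coord p (s p) ≠ 0 := fun h => h0 p hp ((coord p).map_eq_zero_iff.1 h)
    simp [this]
  open_target := hU.prod isOpen_univ
  baseSet := U
  open_baseSet := hU
  source_eq := rfl
  target_eq := rfl
  proj_toFun v _ := rfl

/-- A holomorphic local frame of `(Id, Iso)^* 𝒫`, for the holomorphic structure given by the
`(0,1)`-part of the connection. -/
structure HolFrame (δ : ℕ+) (τ : ℍ) where
  /-- the domain of the frame -/
  U : Set (M δ τ × Mhat δ τ)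
  isOpen_U : IsOpen U
  /-- the section -/
  s : ∀ p, PullGauge δ τ p
  ne_zero : ∀ p ∈ U, s p ≠ 0
  isHol : IsHolSection δ τ U s

/-- The local trivialization given by a holomorphic frame. -/
def HolFrame.triv (e : HolFrame δ τ) : Pretrivialization ℂ (π ℂ (PullGauge δ τ)) :=
  framePretrivialization e.U e.isOpen_U e.s e.ne_zero

theorem contMDiffOn_coordChange (e e' : HolFrame δ τ) :
    ContMDiffOn (𝓘(ℂ, ℂ).prod 𝓘(ℂ, ℂ)) 𝓘(ℂ, ℂ) ∞
      (fun p => coord p (e.s p) / coord p (e'.s p)) (e.U ∩ e'.U) := by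
  have hO := e.isOpen_U.inter e'.isOpen_U
  refine contMDiffOn_of_lift hO ?_
  have h1 : IsHolSection δ τ (e.U ∩ e'.U) e.s :=
    ⟨e.isHol.1.mono fun u hu => hu.1, fun u hu => e.isHol.2 u hu.1⟩
  have h2 : IsHolSection δ τ (e.U ∩ e'.U) e'.s :=
    ⟨e'.isHol.1.mono fun u hu => hu.2, fun u hu => e'.isHol.2 u hu.2⟩
  exact (contDiffOn_div hO h1 h2 fun p hp => e'.ne_zero p hp.2).congr
    fun u _ => coord_div e.s e'.s u

theorem HolFrame.triv_apply (e : HolFrame δ τ) (p : M δ τ × Mhat δ τ) (f : PullGauge δ τ p) :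
    e.triv ⟨p, f⟩ = (p, coord p f / coord p (e.s p)) := rfl

theorem HolFrame.coordChange_apply (e e' : HolFrame δ τ) {p : M δ τ × Mhat δ τ}
    (hp : p ∈ e.U ∩ e'.U) (c : ℂ) :
    ((coord p (e.s p) / coord p (e'.s p)) • ContinuousLinearMap.id ℂ ℂ) c =
      (e'.triv ⟨p, e.triv.symm p c⟩).2 := by
  have h : (⟨p, e.triv.symm p c⟩ : TotalSpace ℂ (PullGauge δ τ)) = ⟨p, c • e.s p⟩ :=
    e.triv.mk_symm hp.1 c
  rw [h, HolFrame.triv_apply]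
  simp
  ring

/-- The local expression of the holomorphic frames used below. -/
def frameFun (δ : ℕ+) (τ : ℍ) (a b : ℂ) (u : ℂ × ℂ) : ℂ :=
  Complex.exp (Complex.I * (isoLift δ τ b (u.1 + a) : ℝ) +
    2 * Real.pi * Complex.I / τ.im * ((u.2 + b) * ((u.1 + a).im : ℝ)))

theorem hasFDerivAt_frameFun (a b : ℂ) (u : ℂ × ℂ) :
    HasFDerivAt (frameFun δ τ a b) (frameFun δ τ a b u •
      (Complex.I • Complex.ofRealCLM.comp ((isoLift δ τ b).comp (ContinuousLinearMap.fst ℝ ℂ ℂ)) +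
        (2 * Real.pi * Complex.I / τ.im) •
          ((u.2 + b) • Complex.ofRealCLM.comp (Complex.imCLM.comp (ContinuousLinearMap.fst ℝ ℂ ℂ)) +
            (((u.1 + a).im : ℝ) : ℂ) • ContinuousLinearMap.snd ℝ ℂ ℂ))) u := by
  have h1 : HasFDerivAt (fun u : ℂ × ℂ => u.1 + a) (ContinuousLinearMap.fst ℝ ℂ ℂ) u :=
    hasFDerivAt_fst.add_const a
  have h2 : HasFDerivAt (fun u : ℂ × ℂ => u.2 + b) (ContinuousLinearMap.snd ℝ ℂ ℂ) u :=
    hasFDerivAt_snd.add_const b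
  have h3 : HasFDerivAt (fun u : ℂ × ℂ => ((isoLift δ τ b (u.1 + a) : ℝ) : ℂ)) _ u :=
    (Complex.ofRealCLM.comp (isoLift δ τ b)).hasFDerivAt.comp u h1
  have h4 : HasFDerivAt (fun u : ℂ × ℂ => (((u.1 + a).im : ℝ) : ℂ)) _ u :=
    (Complex.ofRealCLM.comp Complex.imCLM).hasFDerivAt.comp u h1
  have h5 := ((h3.const_mul Complex.I).add
    ((h2.mul h4).const_mul (2 * Real.pi * Complex.I / τ.im))).cexp
  exact h5

theorem exists_holFrame (p : M δ τ × Mhat δ τ) : ∃ e : HolFrame δ τ, p ∈ e.U := by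
  classical
  set c₁ := chartAt ℂ p.1 with hc₁
  set c₂ := chartAt ℂ p.2 with hc₂
  have hm₁ : ∀ q ∈ c₁.source, mkM δ τ (c₁ q) = q := fun q hq => mk_chart (chart_mem_atlas ℂ p.1) hq
  have hm₂ : ∀ q ∈ c₂.source, mkMhat δ τ (c₂ q) = q :=
    fun q hq => mk_chart (chart_mem_atlas ℂ p.2) hq
  let U : Set (M δ τ × Mhat δ τ) := c₁.source ×ˢ c₂.source
  have hU : IsOpen U := c₁.open_source.prod c₂.open_source
  let F : ℂ → ℂ → ℂ := fun x μ => Complex.exp (2 * Real.pi * Complex.I / τ.im * (μ * (x.im : ℝ)))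
  let s : ∀ q, PullGauge δ τ q := fun q =>
    if h : q ∈ U then (repEquiv q (c₂ q.2) (hm₂ _ h.2)).symm (F (c₁ q.1) (c₂ q.2)) else 0
  have hO : IsOpen (proj δ τ ⁻¹' U) := hU.preimage (continuous_proj δ τ)
  -- the lift of `s` is locally given by an explicit formula
  have hloc : ∀ u ∈ proj δ τ ⁻¹' U, ∃ a b : ℂ, lift δ τ s =ᶠ[𝓝 u] frameFun δ τ a b := by
    intro u hu
    have e1 : ∀ᶠ v in 𝓝 u, c₁ (mkM δ τ v.1) = v.1 + (c₁ (mkM δ τ u.1) - u.1) := by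
      refine eventually_translation (Λ δ τ) ?_ continuousAt_fst ?_
      · exact (c₁.continuousAt hu.1).comp (f := fun v : ℂ × ℂ => mkM δ τ v.1)
          (QuotientAddGroup.continuous_mk.comp continuous_fst).continuousAt
      · filter_upwards [hO.mem_nhds hu] with v hv
        have := QuotientAddGroup.eq.1 (hm₁ _ hv.1).symm
        rwa [neg_add_eq_sub] at this
    have e2 : ∀ᶠ v in 𝓝 u, c₂ (mkMhat δ τ v.2) = v.2 + (c₂ (mkMhat δ τ u.2) - u.2) := by
      refine eventually_translation (Λhat δ τ) ?_ continuousAt_snd ?_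
      · exact (c₂.continuousAt hu.2).comp (f := fun v : ℂ × ℂ => mkMhat δ τ v.2)
          (QuotientAddGroup.continuous_mk.comp continuous_snd).continuousAt
      · filter_upwards [hO.mem_nhds hu] with v hv
        have := QuotientAddGroup.eq.1 (hm₂ _ hv.2).symm
        rwa [neg_add_eq_sub] at this
    refine ⟨c₁ (mkM δ τ u.1) - u.1, c₂ (mkMhat δ τ u.2) - u.2, ?_⟩
    filter_upwards [hO.mem_nhds hu, e1, e2] with v hv h1 h2
    have hs : s (proj δ τ v) = (repEquiv (proj δ τ v) (c₂ (mkMhat δ τ v.2)) (hm₂ _ hv.2)).symm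
        (F (c₁ (mkM δ τ v.1)) (c₂ (mkMhat δ τ v.2))) := dif_pos hv
    have h3 : lift δ τ s v = _ := rep_change (p := proj δ τ v) (x := c₁ (mkM δ τ v.1))
      (μ := c₂ (mkMhat δ τ v.2)) (hm₁ _ hv.1) (hm₂ _ hv.2) rfl _
    rw [h3, hs, ← repEquiv_apply, LinearEquiv.apply_symm_apply, h1, h2, ← Complex.exp_add, frameFun]
    congr 2
    have h4 : v.2 - (v.2 + (c₂ (mkMhat δ τ u.2) - u.2)) = -(c₂ (mkMhat δ τ u.2) - u.2) := by ring
    rw [h4, map_neg, neg_apply]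
    push_cast
    ring
  refine ⟨⟨U, hU, s, ?_, ?_, ?_⟩, mem_chart_source ℂ p.1, mem_chart_source ℂ p.2⟩
  · intro q hq h
    have hs : s q = _ := dif_pos hq
    rw [hs, LinearEquiv.map_eq_zero_iff] at h
    exact Complex.exp_ne_zero _ h
  · intro u hu
    obtain ⟨a, b, h⟩ := hloc u hu
    refine (ContDiffAt.congr_of_eventuallyEq ?_ h).contDiffWithinAt
    have h1 : ContDiff ℝ ∞ fun v : ℂ × ℂ => v.1 + a := contDiff_fst.add contDiff_const
    have h2 : ContDiff ℝ ∞ fun v : ℂ × ℂ => v.2 + b := contDiff_snd.add contDiff_const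
    have h3 := (Complex.ofRealCLM.comp (isoLift δ τ b)).contDiff.comp h1 (n := ∞)
    have h4 := (Complex.ofRealCLM.comp Complex.imCLM).contDiff.comp h1 (n := ∞)
    exact ((contDiff_const.mul h3).add (contDiff_const.mul (h2.mul h4))).cexp.contDiffAt
  · intro u hu w
    obtain ⟨a, b, h⟩ := hloc u hu
    rw [zeroOnePart_eq_zero, nabla, h.fderiv_eq, (hasFDerivAt_frameFun a b u).fderiv, h.self_of_nhds]
    have key : ∀ w : ℂ × ℂ, (Complex.I * (isoLift δ τ b w.1 : ℝ) + 2 * Real.pi * Complex.I / τ.im *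
        ((u.2 + b) * (w.1.im : ℝ) + ((u.1 + a).im : ℝ) * w.2)) +
        Complex.I * (isoLift δ τ u.2 w.1 : ℝ) = 2 * Real.pi * Complex.I / τ.im *
          (((u.2 + b).im : ℝ) * w.1 + ((u.1 + a).im : ℝ) * w.2) := by
      intro w
      rw [isoLift_apply, isoLift_apply]
      apply Complex.ext <;> simp
      ring
    simp only [add_apply, smul_apply, smul_eq_mul, pullConnForm_apply]
    have k1 := key w
    have k2 := key (Complex.I • w)
    simp only [Prod.smul_fst, Prod.smul_snd, smul_eq_mul] at k1 k2
    simp only [ContinuousLinearMap.comp_apply, ContinuousLinearMap.coe_fst',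
      ContinuousLinearMap.coe_snd', Complex.ofRealCLM_apply, Complex.imCLM_apply, Prod.smul_fst,
      Prod.smul_snd, smul_eq_mul]
    linear_combination (frameFun δ τ a b u) * k2 - Complex.I * (frameFun δ τ a b u) * k1

/-- The holomorphic line bundle `(Id, Iso)^* 𝒫`: its local trivializations are those given by
the local frames that are annihilated by the `(0,1)`-part of the connection. -/
def prebundle (δ : ℕ+) (τ : ℍ) : VectorPrebundle ℂ ℂ (PullGauge δ τ) where
  pretrivializationAtlas := Set.range HolFrame.triv
  pretrivialization_linear' := by
    rintro _ ⟨e, rfl⟩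
    refine ⟨fun p _ => ⟨fun f g => ?_, fun c f => ?_⟩⟩
    · simp only [HolFrame.triv_apply, map_add, add_div]
    · simp only [HolFrame.triv_apply, map_smul, smul_eq_mul, mul_div_assoc]
  pretrivializationAt p := (exists_holFrame p).choose.triv
  mem_base_pretrivializationAt p := (exists_holFrame p).choose_spec
  pretrivialization_mem_atlas p := ⟨_, rfl⟩
  exists_coordChange := by
    rintro _ ⟨e, rfl⟩ _ ⟨e', rfl⟩
    exact ⟨fun p => (coord p (e.s p) / coord p (e'.s p)) • ContinuousLinearMap.id ℂ ℂ,
      ((contMDiffOn_coordChange e e').continuousOn).smul continuousOn_const,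
      fun p hp c => e.coordChange_apply e' hp c⟩
  totalSpaceMk_isInducing p := by
    set e := (exists_holFrame p).choose with he
    have hp : p ∈ e.U := (exists_holFrame p).choose_spec
    have h0 : coord p (e.s p) ≠ 0 := fun h => e.ne_zero p hp ((coord p).map_eq_zero_iff.1 h)
    have : FiniteDimensional ℂ (PullGauge δ τ p) := Module.Finite.equiv (coord p).symm
    have h1 : Topology.IsInducing (coord p) :=
      (coord p).toContinuousLinearEquiv.toHomeomorph.isInducing
    have h2 : Topology.IsInducing fun c : ℂ => c * (coord p (e.s p))⁻¹ :=
      (Homeomorph.mulRight₀ _ (inv_ne_zero h0)).isInducing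
    have h3 : Topology.IsInducing fun c : ℂ => (p, c) := Topology.isInducing_const_prod.2 .id
    exact (h3.comp h2).comp h1

instance : TopologicalSpace (TotalSpace ℂ (PullGauge δ τ)) := (prebundle δ τ).totalSpaceTopology

instance : FiberBundle ℂ (PullGauge δ τ) := (prebundle δ τ).toFiberBundle

instance : VectorBundle ℂ ℂ (PullGauge δ τ) := (prebundle δ τ).toVectorBundle

instance : (prebundle δ τ).IsContMDiff (𝓘(ℂ, ℂ).prod 𝓘(ℂ, ℂ)) ∞ where
  exists_contMDiffCoordChange := by
    rintro _ ⟨e, rfl⟩ _ ⟨e', rfl⟩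
    exact ⟨fun p => (coord p (e.s p) / coord p (e'.s p)) • ContinuousLinearMap.id ℂ ℂ,
      (contMDiffOn_coordChange e e').smul contMDiffOn_const,
      fun p hp c => e.coordChange_apply e' hp c⟩

instance : ContMDiffVectorBundle ∞ ℂ (PullGauge δ τ) (𝓘(ℂ, ℂ).prod 𝓘(ℂ, ℂ)) :=
  (prebundle δ τ).contMDiffVectorBundle (IB := 𝓘(ℂ, ℂ).prod 𝓘(ℂ, ℂ))

end Tori

/-! ### Isomorphisms, multipliers and the Poincaré line bundle -/

section HolIso

variable {EB H B : Type*} [NormedAddCommGroup EB] [NormedSpace ℂ EB] [TopologicalSpace H]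
  (I : ModelWithCorners ℂ EB H) [TopologicalSpace B] [ChartedSpace H B]

/-- Two holomorphic line bundles `E`, `E'` over the same complex manifold are isomorphic: there are
linear isomorphisms of the fibres that give a holomorphic map of the total spaces with holomorphic
inverse. -/
def HolIso (E E' : B → Type*)
    [∀ x, AddCommMonoid (E x)] [∀ x, Module ℂ (E x)] [TopologicalSpace (TotalSpace ℂ E)]
    [∀ x, TopologicalSpace (E x)] [FiberBundle ℂ E]
    [∀ x, AddCommMonoid (E' x)] [∀ x, Module ℂ (E' x)] [TopologicalSpace (TotalSpace ℂ E')]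
    [∀ x, TopologicalSpace (E' x)] [FiberBundle ℂ E'] : Prop :=
  ∃ Φ : ∀ x, E x ≃ₗ[ℂ] E' x,
    MDifferentiable (I.prod 𝓘(ℂ, ℂ)) (I.prod 𝓘(ℂ, ℂ))
      (fun v : TotalSpace ℂ E => TotalSpace.mk' ℂ (E := E') v.1 (Φ v.1 v.2)) ∧
    MDifferentiable (I.prod 𝓘(ℂ, ℂ)) (I.prod 𝓘(ℂ, ℂ))
      (fun v : TotalSpace ℂ E' => TotalSpace.mk' ℂ (E := E) v.1 ((Φ v.1).symm v.2))

end HolIso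

/-- The holomorphic line bundle `E` over `ℂ ⧸ Γ` is given by the multipliers `e l : ℂ → ℂ`,
`l ∈ Γ`: its pull-back to `ℂ` has a nowhere vanishing holomorphic section `s`, hence a trivialization
`φ`, such that a function `θ` with `θ (z + l) = e l z * θ z` for all `l ∈ Γ` corresponds to a
section `θ s` that descends to `E`; in other words `s (z + l) = (e l z)⁻¹ • s z`. -/
def HasMultipliers {Γ : AddSubgroup ℂ} [DiscreteTopology Γ] (E : ℂ ⧸ Γ → Type*)
    [∀ x, AddCommMonoid (E x)] [∀ x, Module ℂ (E x)] [TopologicalSpace (TotalSpace ℂ E)]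
    [∀ x, TopologicalSpace (E x)] [FiberBundle ℂ E] (e : ℂ → ℂ → ℂ) : Prop :=
  ∃ s : ∀ z : ℂ, E (QuotientAddGroup.mk z),
    MDifferentiable 𝓘(ℂ, ℂ) (𝓘(ℂ, ℂ).prod 𝓘(ℂ, ℂ))
      (fun z => TotalSpace.mk' ℂ (E := E) (QuotientAddGroup.mk z) (s z)) ∧
    (∀ z, s z ≠ 0) ∧
    ∀ l ∈ Γ, ∀ z, TotalSpace.mk' ℂ (E := E) (QuotientAddGroup.mk (z + l)) (s (z + l)) =
      TotalSpace.mk' ℂ (QuotientAddGroup.mk z) ((e l z)⁻¹ • s z)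

section Poincare

variable (δ : ℕ+) (τ : ℍ)

/-- The inclusion of the slice `M × {y}`. -/
def sliceM (y : Mhat δ τ) : ContMDiffMap 𝓘(ℂ, ℂ) (𝓘(ℂ, ℂ).prod 𝓘(ℂ, ℂ))
    (M δ τ) (M δ τ × Mhat δ τ) ∞ :=
  ⟨fun x => (x, y), contMDiff_id.prodMk contMDiff_const⟩

/-- The inclusion of the slice `{x} × M̂`. -/
def sliceMhat (x : M δ τ) : ContMDiffMap 𝓘(ℂ, ℂ) (𝓘(ℂ, ℂ).prod 𝓘(ℂ, ℂ))
    (Mhat δ τ) (M δ τ × Mhat δ τ) ∞ :=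
  ⟨fun y => (x, y), contMDiff_const.prodMk contMDiff_id⟩

/-- The multipliers `e_l = exp(2πi α(l))` of the line bundle `P_μ̂` on `M` that corresponds to the
point of `Pic⁰(M) = V̄* / Λ̄*` represented by the conjugate linear form `α = μ̂ e₁*`. -/
def picMultiplier (μ l _z : ℂ) : ℂ := Complex.exp (2 * Real.pi * Complex.I * (μ * eStar τ l))

/-- `P → M × M̂` is a Poincaré line bundle: its restriction to `M × {[μ̂]}` is isomorphic to `P_μ̂` for
every `μ̂`, and its restriction to `{0} × M̂` is holomorphically trivial. -/
def IsPoincareBundle (P : M δ τ × Mhat δ τ → Type*)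
    [∀ p, AddCommMonoid (P p)] [∀ p, Module ℂ (P p)] [TopologicalSpace (TotalSpace ℂ P)]
    [∀ p, TopologicalSpace (P p)] [FiberBundle ℂ P] [VectorBundle ℂ ℂ P] : Prop :=
  (∀ μ : ℂ, HasMultipliers (sliceM δ τ (mkMhat δ τ μ) *ᵖ P) (picMultiplier τ μ)) ∧
    HolIso 𝓘(ℂ, ℂ) (sliceMhat δ τ 0 *ᵖ P) (Bundle.Trivial (Mhat δ τ) ℂ)

end Poincare

end CTorus

end

/-! Uniqueness. Two Poincaré bundles `P`, `P'` have the same multipliers on every slice `M × {y}`,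
so over each slice there is a holomorphic isomorphism. Its scalar is fixed by requiring that over
the origin it match the given trivializations along `{0} × M̂`. The resulting fibrewise isomorphism
`Ψ` is holomorphic along each `M × {y}` and along `{0} × M̂`. The main point is that it is then
jointly holomorphic (`mdifferentiable_of_slices`).

Fix a parameter `μ₀` and cover `M × {μ₀}` by finitely many trivializations. Dividing the local
coefficients of `Ψ` by their values at `μ₀` makes all their ratios equal to 1 at `μ₀`. Choosing one
trivialization near each point then gives a periodic function `h μ` on `V`. It need not be
continuous, but on every disc of a fixed radius it is within `O(|μ - μ₀|)` of a holomorphic function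
as soon as it is bounded. A bounded periodic function that is `ε`-close to holomorphic functions in
this way oscillates by at most `K ε` (`exists_liouville_bound`): starting from a point where the
real part is nearly maximal, the Borel–Carathéodory inequality propagates near constancy in finitely
many steps. As `h μ 0` is differentiable in `μ`, it follows that `h μ = 1 + O(|μ - μ₀|)`
(`exists_h_bounds`). The same Liouville bound, applied to the difference of two difference quotients
in `μ`, shows that these quotients are Cauchy, uniformly in `z` (`exists_quot_bound`). This gives
complex differentiability in both variables at every point of the slice `μ = μ₀`.

Existence. The function `exp(2πi μ̂ Im z / τ₂)` on `V × V̄*` is annihilated by the `(0,1)`-part of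
the connection (`nabla_frameFun`), so its quotients by local holomorphic frames are holomorphic. For
fixed `μ̂`, multiplication by the entire function `exp(-π μ̂ z / τ₂)` turns it into `exp(-π μ̂ z̄ /
τ₂)`, which transforms by the inverse multipliers of `P_μ̂`. Over `x = 0` the lattice acts trivially
on the fibre coordinate, so that coordinate descends to a trivialization along `{0} × M̂`. -/

noncomputable section

namespace CTorus

/-! ### Approximate Liouville theorem and divided differences -/

section Analysis

open Metric Set

/-- The Borel–Carathéodory inequality on the concentric disc of a third of the radius. -/
theorem norm_sub_center_le {v : ℂ → ℂ} {c : ℂ} {r A : ℝ} (hr : 0 < r) (hA : 0 < A)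
    (hv : DifferentiableOn ℂ v (ball c r)) (hre : ∀ w ∈ ball c r, (v w - v c).re ≤ A) {z : ℂ}
    (hz : dist z c ≤ r / 3) : ‖v z - v c‖ ≤ A := by
  have hm : MapsTo (fun w => w + c) (ball 0 r) (ball c r) := fun w hw => by
    simpa [dist_eq_norm] using hw
  have h := Complex.borelCaratheodory_zero (f := fun w => v (w + c) - v c) (M := A) (R := r)
    (z := z - c) hA ((hv.comp (by fun_prop) hm).sub_const _) (fun w hw => hre _ (hm hw)) hr
    (by rw [mem_ball_zero_iff, ← dist_eq_norm]; linarith) (by simp)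
  rw [dist_eq_norm] at hz
  simp only [sub_add_cancel] at h
  refine h.trans ?_
  -- The bound `2 A s / (r - s)` at distance `s ≤ r / 3` from the centre is at most `A`.
  rw [div_le_iff₀ (by linarith)]
  nlinarith [mul_le_mul_of_nonneg_left hz hA.le]

/-- A bounded function that is close to a holomorphic function on every disc of radius `r`, and
whose real part is nearly maximal at `z₀`, is nearly constant near `z₀`. -/
theorem exists_near_max_bound {r : ℝ} (hr : 0 < r) (n : ℕ) : ∃ K : ℝ, 0 < K ∧
    ∀ (ε S : ℝ) (h : ℂ → ℂ) (z₀ : ℂ), 0 < ε → (∀ z, (h z).re ≤ S) → S - ε ≤ (h z₀).re →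
      (∀ c, ∃ v : ℂ → ℂ, DifferentiableOn ℂ v (ball c r) ∧ ∀ w ∈ ball c r, ‖v w - h w‖ ≤ ε) →
      ∀ z, dist z z₀ ≤ n * (r / 3) → ‖h z - h z₀‖ ≤ K * ε := by
  induction n with
  | zero =>
    refine ⟨1, one_pos, fun ε S h z₀ hε _ _ _ z hz => ?_⟩
    have : z = z₀ := by simpa using hz
    simp [this, hε.le]
  | succ n ih =>
    obtain ⟨K, hK, ih⟩ := ih
    -- One more step costs `(K + 3) ε` for the holomorphic approximation, `ε` at each of its two
    -- ends, and `K ε` from the induction.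
    refine ⟨2 * K + 5, by positivity, fun ε S h z₀ hε hS h₀ hh z hz => ?_⟩
    have hn : (0 : ℝ) < n + 1 := by positivity
    -- The point `y` divides the segment so that `z₀` is `n` steps of length `r / 3` away and `z` a
    -- single one.
    set y : ℂ := z₀ + ((n / (n + 1) : ℝ) : ℂ) * (z - z₀) with hy
    have hyz : y - z₀ = ((n / (n + 1) : ℝ) : ℂ) * (z - z₀) := by rw [hy]; ring
    have hzy : z - y = ((1 / (n + 1) : ℝ) : ℂ) * (z - z₀) := by
      have : ((1 / (n + 1) : ℝ) : ℂ) = 1 - ((n / (n + 1) : ℝ) : ℂ) := by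
        rw [← Complex.ofReal_one, ← Complex.ofReal_sub]
        congr 1
        field_simp
        ring
      rw [this, hy]
      ring
    rw [dist_eq_norm] at hz
    push_cast at hz
    have h1 : dist y z₀ ≤ n * (r / 3) := by
      rw [dist_eq_norm, hyz, norm_mul, Complex.norm_real, Real.norm_of_nonneg (by positivity),
        div_mul_eq_mul_div, div_le_iff₀ hn]
      nlinarith [mul_le_mul_of_nonneg_left hz (Nat.cast_nonneg (α := ℝ) n)]
    have h2 : dist z y ≤ r / 3 := by
      rw [dist_eq_norm, hzy, norm_mul, Complex.norm_real, Real.norm_of_nonneg (by positivity),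
        div_mul_eq_mul_div, div_le_iff₀ hn]
      linarith
    have hyb := ih ε S h z₀ hε hS h₀ hh y h1
    obtain ⟨v, hv, hvh⟩ := hh y
    have hyr : S - ε - K * ε ≤ (h y).re := by
      have := (abs_le.1 ((Complex.abs_re_le_norm _).trans hyb)).1
      rw [Complex.sub_re] at this
      linarith
    have hve : ∀ w ∈ ball y r, |(v w).re - (h w).re| ≤ ε := fun w hw => by
      rw [← Complex.sub_re]
      exact (Complex.abs_re_le_norm _).trans (hvh w hw)
    -- The real part of `h` is at most `S` everywhere and at least `S - (K + 1) ε` at `y`; passing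
    -- from `h` to `v` at `w` and at `y` adds `2 ε`.
    have hc := norm_sub_center_le (A := (K + 3) * ε) hr (by positivity) hv (fun w hw => by
      have a1 := abs_le.1 (hve w hw)
      have a2 := abs_le.1 (hve y (mem_ball_self hr))
      have a3 := hS w
      rw [Complex.sub_re]
      linarith) h2
    have hz1 := hvh z (by rw [mem_ball]; linarith)
    have hy1 := hvh y (mem_ball_self hr)
    calc ‖h z - h z₀‖ = ‖(v z - v y) - (v z - h z) + (v y - h y) + (h y - h z₀)‖ := by ring_nf
      _ ≤ (K + 3) * ε + ε + ε + K * ε := by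
        refine (norm_add_le _ _).trans (add_le_add ((norm_add_le _ _).trans (add_le_add
          ((norm_sub_le _ _).trans (add_le_add hc hz1)) hy1)) hyb)
      _ = (2 * K + 5) * ε := by ring

/-- Liouville's theorem for approximately holomorphic periodic functions. -/
theorem exists_liouville_bound {Γ : AddSubgroup ℂ} {R r : ℝ} (hr : 0 < r)
    (hR : ∀ z : ℂ, ∃ l ∈ Γ, ‖z + l‖ ≤ R) : ∃ K : ℝ, 0 < K ∧
    ∀ (ε : ℝ) (h : ℂ → ℂ), 0 ≤ ε → (∃ S, ∀ z, ‖h z‖ ≤ S) → (∀ l ∈ Γ, ∀ z, h (z + l) = h z) →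
      (∀ c, ∃ v : ℂ → ℂ, DifferentiableOn ℂ v (ball c r) ∧ ∀ w ∈ ball c r, ‖v w - h w‖ ≤ ε) →
      ∀ z z', ‖h z - h z'‖ ≤ K * ε := by
  obtain ⟨n, hn⟩ := exists_nat_ge (R / (r / 3))
  rw [div_le_iff₀ (by positivity)] at hn
  obtain ⟨K, hK, hb⟩ := exists_near_max_bound hr n
  refine ⟨2 * K, by positivity, fun ε h hε ⟨S, hS⟩ hper hh z z' => ?_⟩
  -- The supremum of the real part need not be attained, and `ε` may be 0, so a strictly positive
  -- margin is needed; `ε'` tends to `ε` at the end.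
  have key : ∀ ε' > ε, ‖h z - h z'‖ ≤ 2 * K * ε' := by
    intro ε' hε'
    have hbdd : BddAbove (range fun z => (h z).re) :=
      ⟨S, by rintro _ ⟨z, rfl⟩; exact (Complex.re_le_norm _).trans (hS z)⟩
    obtain ⟨z₀, hz₀⟩ := exists_lt_of_lt_ciSup (f := fun z => (h z).re)
      (b := (⨆ z, (h z).re) - ε') (by linarith)
    have h1 : ∀ z, ‖h z - h z₀‖ ≤ K * ε' := by
      intro z
      obtain ⟨l, hl, hle⟩ := hR (z - z₀)
      -- By periodicity `z` may be replaced by a translate within `R` of the near-maximum `z₀`.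
      rw [← hper l hl z]
      refine hb ε' _ h z₀ (hε.trans_lt hε') (fun z => le_ciSup hbdd z) hz₀.le
        (fun c => ?_) _ ?_
      · obtain ⟨v, hv, hvh⟩ := hh c
        exact ⟨v, hv, fun w hw => (hvh w hw).trans hε'.le⟩
      · rw [dist_eq_norm, add_sub_right_comm]
        exact hle.trans hn
    calc ‖h z - h z'‖ = ‖(h z - h z₀) - (h z' - h z₀)‖ := by ring_nf
      _ ≤ K * ε' + K * ε' := (norm_sub_le _ _).trans (add_le_add (h1 z) (h1 z'))
      _ = 2 * K * ε' := by ring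
  refine le_of_forall_gt_imp_ge_of_dense fun b hb => ?_
  have := key (b / (2 * K)) (by rwa [gt_iff_lt, lt_div_iff₀ (by positivity), mul_comm])
  rwa [mul_div_cancel₀ _ (by positivity)] at this

/-- Schwarz lemma: `G` maps the disc into the closed disc of radius `2 B` about `G c`. -/
theorem norm_dslope_le {G : ℂ → ℂ} {c : ℂ} {ρ B : ℝ} (hρ : 0 < ρ)
    (hd : DifferentiableOn ℂ G (ball c ρ)) (hB : ∀ μ ∈ ball c ρ, ‖G μ‖ ≤ B) {μ : ℂ}
    (hμ : μ ∈ ball c ρ) : ‖dslope G c μ‖ ≤ 2 * B / ρ := by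
  refine Complex.norm_dslope_le_div_of_mapsTo_ball hd (fun w hw => ?_) hμ
  rw [mem_closedBall, dist_eq_norm, two_mul]
  exact (norm_sub_le _ _).trans (add_le_add (hB w hw) (hB c (mem_ball_self hρ)))

/-- The divided difference is itself holomorphic and bounded, so the previous bound applies to its
own divided difference. -/
theorem norm_dslope_sub_le {G : ℂ → ℂ} {c : ℂ} {ρ B : ℝ} (hρ : 0 < ρ)
    (hd : DifferentiableOn ℂ G (ball c ρ)) (hB : ∀ μ ∈ ball c ρ, ‖G μ‖ ≤ B) {μ : ℂ}
    (hμ : μ ∈ ball c ρ) :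
    ‖dslope G c μ - dslope G c c‖ ≤ 2 * (2 * B / ρ) / ρ * ‖μ - c‖ := by
  have hd' : DifferentiableOn ℂ (dslope G c) (ball c ρ) :=
    (Complex.differentiableOn_dslope (ball_mem_nhds c hρ)).2 hd
  have h := norm_dslope_le hρ hd' (fun w hw => norm_dslope_le hρ hd hB hw) hμ
  rw [← sub_smul_dslope (dslope G c) c μ, norm_smul, mul_comm]
  gcongr

end Analysis

/-! ### Families holomorphic along slices: differentiability in the parameter -/

section Family

open Metric Set Filter

/-- Local expressions `q t`, `t ∈ T`, of an isomorphism of two line bundles over the product of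
`ℂ ⧸ Γ` with a disc, holomorphic along the slices `ℂ ⧸ Γ × {μ}`, in local trivializations that are
indexed by `T` and cover `ℂ ⧸ Γ × {μ₀}`. -/
structure SliceFamily (Γ : AddSubgroup ℂ) (μ₀ : ℂ) (T : Type*) where
  /-- the domains of the trivializations -/
  C : T → Set ℂ
  /-- a choice of a trivialization near each point -/
  a : ℂ → T
  /-- the radius of discs contained in the domains -/
  r : ℝ
  /-- the radius of the disc of parameters -/
  ρ : ℝ
  /-- a bound for the coordinate changes -/
  B : ℝ
  r_pos : 0 < r
  ρ_pos : 0 < ρ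
  /-- the local expressions -/
  q : T → ℂ → ℂ → ℂ
  ball_subset : ∀ z, ball z r ⊆ C (a z)
  a_add : ∀ l ∈ Γ, ∀ z, a (z + l) = a z
  q_add : ∀ l ∈ Γ, ∀ t z μ, q t (z + l) μ = q t z μ
  q_diff : ∀ t, ∀ μ ∈ ball μ₀ ρ, DifferentiableOn ℂ (fun z => q t z μ) (C t)
  q_ne : ∀ t, ∀ z ∈ C t, ∀ μ ∈ ball μ₀ ρ, q t z μ ≠ 0
  ratio_diff : ∀ s t, ∀ z ∈ C s ∩ C t,
    DifferentiableOn ℂ (fun μ => q s z μ / q t z μ) (ball μ₀ ρ)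
  ratio_le : ∀ s t, ∀ z ∈ C s ∩ C t, ∀ μ ∈ ball μ₀ ρ, ‖q s z μ / q t z μ‖ ≤ B
  base_diff : DifferentiableAt ℂ (fun μ => q (a 0) 0 μ) μ₀

namespace SliceFamily

variable {Γ : AddSubgroup ℂ} {μ₀ : ℂ} {T : Type*} (A : SliceFamily Γ μ₀ T)

/-- The local expression in the chosen trivialization near `z`. -/
def h (μ z : ℂ) : ℂ := A.q (A.a z) z μ

theorem h_add (μ : ℂ) {l : ℂ} (hl : l ∈ Γ) (z : ℂ) : A.h μ (z + l) = A.h μ z := by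
  simp only [h, A.a_add l hl, A.q_add l hl]

theorem mem_C {z w : ℂ} (hw : w ∈ ball z A.r) : w ∈ A.C (A.a z) ∩ A.C (A.a w) :=
  ⟨A.ball_subset z hw, A.ball_subset w (mem_ball_self A.r_pos)⟩

theorem q_eq {z w μ : ℂ} (hw : w ∈ ball z A.r) (hμ : μ ∈ ball μ₀ A.ρ) :
    A.q (A.a z) w μ = A.q (A.a z) w μ / A.q (A.a w) w μ * A.h μ w := by
  rw [h, div_mul_cancel₀ _ (A.q_ne _ _ (A.mem_C hw).2 μ hμ)]

/-- The choice `a` may jump, so `h μ` need not be continuous. Near each point it is a ratio bounded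
by `B` times one fixed continuous expression; compactness and periodicity do the rest. -/
theorem exists_bound {R : ℝ} (hR : ∀ z : ℂ, ∃ l ∈ Γ, ‖z + l‖ ≤ R) {μ : ℂ}
    (hμ : μ ∈ ball μ₀ A.ρ) : ∃ S, ∀ z, ‖A.h μ z‖ ≤ S := by
  obtain ⟨S, hS⟩ : ∃ S, ∀ z ∈ closedBall (0 : ℂ) R, ‖A.h μ z‖ ≤ S := by
    refine (isCompact_closedBall (0 : ℂ) R).induction_on
      (p := fun s => ∃ S, ∀ z ∈ s, ‖A.h μ z‖ ≤ S) ⟨0, by simp⟩ ?_ ?_ ?_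
    · rintro s t hst ⟨S, hS⟩
      exact ⟨S, fun z hz => hS z (hst hz)⟩
    · rintro s t ⟨S, hS⟩ ⟨S', hS'⟩
      refine ⟨max S S', fun z hz => ?_⟩
      rcases hz with hz | hz
      exacts [(hS z hz).trans (le_max_left _ _), (hS' z hz).trans (le_max_right _ _)]
    · intro z _
      have hb := ball_mem_nhds z A.r_pos
      have hc : ContinuousAt (fun w => A.q (A.a z) w μ) z :=
        (((A.q_diff _ μ hμ).mono (A.ball_subset z)).differentiableAt hb).continuousAt
      have hb' : ∀ᶠ w in 𝓝 z, ‖A.q (A.a z) w μ‖ < ‖A.q (A.a z) z μ‖ + 1 :=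
        hc.norm.eventually_lt_const (lt_add_one _)
      refine ⟨_, mem_nhdsWithin_of_mem_nhds (inter_mem hb hb'),
        A.B * (‖A.q (A.a z) z μ‖ + 1), fun w hw => ?_⟩
      have e : A.h μ w = A.q (A.a w) w μ / A.q (A.a z) w μ * A.q (A.a z) w μ := by
        rw [h, div_mul_cancel₀ _ (A.q_ne _ _ (A.mem_C hw.1).1 μ hμ)]
      have h1 := A.ratio_le _ _ w (A.mem_C hw.1).symm μ hμ
      rw [e, norm_mul]
      exact mul_le_mul h1 (le_of_lt hw.2) (norm_nonneg _) ((norm_nonneg _).trans h1)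
  refine ⟨S, fun z => ?_⟩
  obtain ⟨l, hl, hle⟩ := hR z
  rw [← A.h_add μ hl]
  exact hS _ (by simpa using hle)

section Normalized

variable (h1 : ∀ t, ∀ z ∈ A.C t, A.q t z μ₀ = 1)
include h1

/-- The divided difference of a coordinate change. -/
def ratioSlope (z w : ℂ) : ℂ → ℂ :=
  dslope (fun μ => A.q (A.a z) w μ / A.q (A.a w) w μ) μ₀

/-- Normalization makes every ratio equal to 1 at `μ₀`, which produces the factor `μ - μ₀`. This is
the estimate of how far `h μ` is from being holomorphic near `z`. -/
theorem q_sub_h {z w μ : ℂ} (hw : w ∈ ball z A.r) (hμ : μ ∈ ball μ₀ A.ρ) :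
    A.q (A.a z) w μ - A.h μ w = (μ - μ₀) * A.ratioSlope z w μ * A.h μ w := by
  have h := sub_smul_dslope (fun μ => A.q (A.a z) w μ / A.q (A.a w) w μ) μ₀ μ
  rw [h1 _ _ (A.mem_C hw).1, h1 _ _ (A.mem_C hw).2, div_one, smul_eq_mul] at h
  rw [ratioSlope, h, sub_mul, one_mul, ← A.q_eq hw hμ]

omit h1 in
theorem ratioSlope_le {z w μ : ℂ} (hw : w ∈ ball z A.r) (hμ : μ ∈ ball μ₀ A.ρ) :
    ‖A.ratioSlope z w μ‖ ≤ 2 * A.B / A.ρ :=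
  norm_dslope_le A.ρ_pos (A.ratio_diff _ _ w (A.mem_C hw)) (A.ratio_le _ _ w (A.mem_C hw)) hμ

omit h1 in
theorem ratioSlope_sub_le {z w μ ν : ℂ} (hw : w ∈ ball z A.r) (hμ : μ ∈ ball μ₀ A.ρ)
    (hν : ν ∈ ball μ₀ A.ρ) : ‖A.ratioSlope z w μ - A.ratioSlope z w ν‖ ≤
      2 * (2 * A.B / A.ρ) / A.ρ * (‖μ - μ₀‖ + ‖ν - μ₀‖) := by
  have h := fun ξ (hξ : ξ ∈ ball μ₀ A.ρ) => norm_dslope_sub_le A.ρ_pos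
    (A.ratio_diff _ _ w (A.mem_C hw)) (A.ratio_le _ _ w (A.mem_C hw)) hξ
  calc ‖A.ratioSlope z w μ - A.ratioSlope z w ν‖ = ‖(A.ratioSlope z w μ - A.ratioSlope z w μ₀) -
        (A.ratioSlope z w ν - A.ratioSlope z w μ₀)‖ := by ring_nf
    _ ≤ _ := by
      rw [mul_add]
      exact (norm_sub_le _ _).trans (add_le_add (h μ hμ) (h ν hν))

theorem h_center (z : ℂ) : A.h μ₀ z = 1 := h1 _ _ (A.ball_subset z (mem_ball_self A.r_pos))

/-- The deviation of `h μ` from holomorphy is proportional to its own supremum, so a uniform bound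
has to come first. With it, the Liouville bound compares `h μ z` with `h μ 0`, and differentiability
at the base point compares `h μ 0` with 1. -/
theorem exists_h_bounds {R : ℝ} (hR : ∀ z : ℂ, ∃ l ∈ Γ, ‖z + l‖ ≤ R) :
    ∃ K, 0 ≤ K ∧ ∀ᶠ μ in 𝓝 μ₀, μ ∈ ball μ₀ A.ρ ∧ ∀ z, ‖A.h μ z‖ ≤ 4 ∧
      ‖A.h μ z - 1‖ ≤ K * ‖μ - μ₀‖ := by
  obtain ⟨K, hK, hb⟩ := exists_liouville_bound A.r_pos hR
  obtain ⟨K', hK'⟩ := A.base_diff.isBigO_sub.bound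
  have hB : 0 ≤ A.B := (norm_nonneg _).trans (A.ratio_le _ _ 0
    (A.mem_C (mem_ball_self A.r_pos)) μ₀ (mem_ball_self A.ρ_pos))
  set B₁ := 2 * A.B / A.ρ with hB₁
  have hB₁0 : 0 ≤ B₁ := div_nonneg (by positivity) A.ρ_pos.le
  have hsmall : ∀ c : ℝ, ∀ᶠ μ in 𝓝 μ₀, c * ‖μ - μ₀‖ < 1 / 2 := fun c => by
    have : Tendsto (fun μ => c * ‖μ - μ₀‖) (𝓝 μ₀) (𝓝 (c * ‖μ₀ - μ₀‖)) :=
      (continuous_const.mul (continuous_id.sub continuous_const).norm).tendsto μ₀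
    exact this.eventually_lt_const (by simp)
  refine ⟨K * (B₁ * 4) + |K'|, by positivity, ?_⟩
  filter_upwards [hK', ball_mem_nhds μ₀ A.ρ_pos, hsmall (K * B₁), hsmall K'] with μ m1 m2 m3 m4
  have hd : ∀ S, (∀ z, ‖A.h μ z‖ ≤ S) → ∀ z, ‖A.h μ z - A.h μ 0‖ ≤
      K * (‖μ - μ₀‖ * B₁ * S) := by
    intro S hS z
    have hS0 : 0 ≤ S := (norm_nonneg _).trans (hS 0)
    refine hb _ (A.h μ) (by positivity) ⟨S, hS⟩ (fun l hl => A.h_add μ hl) (fun c => ?_) z 0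
    refine ⟨fun w => A.q (A.a c) w μ, (A.q_diff _ μ m2).mono (A.ball_subset c), fun w hw => ?_⟩
    rw [A.q_sub_h h1 hw m2, norm_mul, norm_mul]
    have := A.ratioSlope_le hw m2
    gcongr
    exact hS w
  change ‖A.h μ 0 - A.h μ₀ 0‖ ≤ _ at m1
  rw [A.h_center h1] at m1
  have h0 : ‖A.h μ 0‖ ≤ 2 := by
    calc ‖A.h μ 0‖ = ‖(A.h μ 0 - 1) + 1‖ := by ring_nf
      _ ≤ 1 / 2 + 1 := (norm_add_le _ _).trans (add_le_add (m1.trans m4.le) (by simp))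
      _ ≤ 2 := by norm_num
  -- Absorption: near `μ₀` the oscillation is at most half the supremum `S`, so `S ≤ 2 + S / 2`. The
  -- finiteness of `S` is essential here.
  have h4 : ∀ z, ‖A.h μ z‖ ≤ 4 := by
    obtain ⟨S₀, hS₀⟩ := A.exists_bound hR m2
    have hbdd : BddAbove (range fun z => ‖A.h μ z‖) := ⟨S₀, by rintro _ ⟨z, rfl⟩; exact hS₀ z⟩
    set S := ⨆ z, ‖A.h μ z‖ with hS
    have hle : ∀ z, ‖A.h μ z‖ ≤ S := fun z => le_ciSup hbdd z
    have hS0 : 0 ≤ S := (norm_nonneg _).trans (hle 0)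
    have : S ≤ 2 + S / 2 := by
      refine ciSup_le fun z => ?_
      calc ‖A.h μ z‖ = ‖(A.h μ z - A.h μ 0) + A.h μ 0‖ := by ring_nf
        _ ≤ K * (‖μ - μ₀‖ * B₁ * S) + 2 := (norm_add_le _ _).trans (add_le_add (hd S hle z) h0)
        _ = K * B₁ * ‖μ - μ₀‖ * S + 2 := by ring
        _ ≤ 2 + S / 2 := by nlinarith
    exact fun z => (hle z).trans (by linarith)
  refine ⟨m2, fun z => ⟨h4 z, ?_⟩⟩
  calc ‖A.h μ z - 1‖ = ‖(A.h μ z - A.h μ 0) + (A.h μ 0 - 1)‖ := by ring_nf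
    _ ≤ K * (‖μ - μ₀‖ * B₁ * 4) + |K'| * ‖μ - μ₀‖ :=
      (norm_add_le _ _).trans (add_le_add (hd 4 h4 z)
        (m1.trans (mul_le_mul_of_nonneg_right (le_abs_self K') (norm_nonneg _))))
    _ = _ := by ring

/-- The difference quotient of the local expression at `μ₀` with respect to the parameter. -/
def quot (z₀ μ w : ℂ) : ℂ := (A.q (A.a z₀) w μ - 1) / (μ - μ₀)

/-- A Cauchy estimate uniform in the point: two difference quotients differ everywhere by little
more than they do at the origin, where they converge by assumption. -/
theorem exists_quot_bound {R : ℝ} (hR : ∀ z : ℂ, ∃ l ∈ Γ, ‖z + l‖ ≤ R) :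
    ∃ K, 0 ≤ K ∧ ∀ᶠ μ in 𝓝[≠] μ₀, ∀ᶠ ν in 𝓝[≠] μ₀, ∀ z₀, ∀ w ∈ ball z₀ A.r,
      ‖A.quot z₀ μ w - A.quot z₀ ν w‖ ≤ K * (‖μ - μ₀‖ + ‖ν - μ₀‖) +
        ‖A.quot 0 μ 0 - A.quot 0 ν 0‖ := by
  obtain ⟨K, hK, hb⟩ := exists_liouville_bound A.r_pos hR
  obtain ⟨K₁, hK₁, hev⟩ := A.exists_h_bounds h1 hR
  have hB : 0 ≤ A.B := (norm_nonneg _).trans (A.ratio_le _ _ 0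
    (A.mem_C (mem_ball_self A.r_pos)) μ₀ (mem_ball_self A.ρ_pos))
  set B₁ := 2 * A.B / A.ρ with hB₁
  have hB₁0 : 0 ≤ B₁ := div_nonneg (by positivity) A.ρ_pos.le
  set B₂ := 2 * B₁ / A.ρ with hB₂
  have hB₂0 : 0 ≤ B₂ := div_nonneg (by positivity) A.ρ_pos.le
  set K₂ := B₂ * 4 + B₁ * K₁ with hK₂
  have hK₂0 : 0 ≤ K₂ := by positivity
  have hev' := (hev.filter_mono nhdsWithin_le_nhds).and (self_mem_nhdsWithin (s := {μ₀}ᶜ))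
  refine ⟨K₂ + K * K₂, by positivity, ?_⟩
  filter_upwards [hev'] with μ ⟨⟨mμ, hμ⟩, nμ⟩
  filter_upwards [hev'] with ν ⟨⟨mν, hν⟩, nν⟩
  have sμ : μ - μ₀ ≠ 0 := sub_ne_zero.2 nμ
  have sν : ν - μ₀ ≠ 0 := sub_ne_zero.2 nν
  -- The periodic counterpart of `quot z₀ μ - quot z₀ ν`, to which the Liouville bound applies.
  let d : ℂ → ℂ := fun z => (A.h μ z - 1) / (μ - μ₀) - (A.h ν z - 1) / (ν - μ₀)
  have hd : ∀ z₀, ∀ w ∈ ball z₀ A.r, ‖(A.quot z₀ μ w - A.quot z₀ ν w) - d w‖ ≤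
      K₂ * (‖μ - μ₀‖ + ‖ν - μ₀‖) := by
    intro z₀ w hw
    -- Division by `μ - μ₀` leaves `ratioSlope * h`; the difference of two such products is small
    -- because both factors vary by `O(‖μ - μ₀‖ + ‖ν - μ₀‖)`.
    have e : (A.quot z₀ μ w - A.quot z₀ ν w) - d w =
        (A.ratioSlope z₀ w μ - A.ratioSlope z₀ w ν) * A.h μ w +
          A.ratioSlope z₀ w ν * ((A.h μ w - 1) - (A.h ν w - 1)) := by
      have e1 : (A.quot z₀ μ w - A.quot z₀ ν w) - d w =
          (A.q (A.a z₀) w μ - A.h μ w) / (μ - μ₀) - (A.q (A.a z₀) w ν - A.h ν w) / (ν - μ₀) := by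
        simp only [quot, d]
        ring
      rw [e1, A.q_sub_h h1 hw mμ, A.q_sub_h h1 hw mν, mul_assoc, mul_assoc,
        mul_div_cancel_left₀ _ sμ, mul_div_cancel_left₀ _ sν]
      ring
    have r1 := A.ratioSlope_sub_le hw mμ mν
    have r2 := A.ratioSlope_le hw mν
    rw [e]
    calc _ ≤ (B₂ * (‖μ - μ₀‖ + ‖ν - μ₀‖)) * 4 + B₁ * (K₁ * ‖μ - μ₀‖ + K₁ * ‖ν - μ₀‖) := by
          refine (norm_add_le _ _).trans (add_le_add ?_ ?_)
          · rw [norm_mul]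
            exact mul_le_mul r1 (hμ w).1 (norm_nonneg _) (by positivity)
          · rw [norm_mul]
            exact mul_le_mul r2 ((norm_sub_le _ _).trans (add_le_add (hμ w).2 (hν w).2))
              (norm_nonneg _) hB₁0
      _ = _ := by rw [hK₂]; ring
  have hdd : ∀ z, ‖d z - d 0‖ ≤ K * (K₂ * (‖μ - μ₀‖ + ‖ν - μ₀‖)) := by
    intro z
    refine hb _ d (by positivity) ⟨K₁ + K₁, fun z => ?_⟩ (fun l hl z => ?_) (fun c => ?_) z 0
    · refine (norm_sub_le _ _).trans (add_le_add ?_ ?_)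
      · rw [norm_div, div_le_iff₀ (norm_pos_iff.2 sμ)]
        exact (hμ z).2
      · rw [norm_div, div_le_iff₀ (norm_pos_iff.2 sν)]
        exact (hν z).2
    · simp only [d, A.h_add _ hl]
    · refine ⟨fun w => A.quot c μ w - A.quot c ν w, ?_, hd c⟩
      exact ((((A.q_diff _ μ mμ).mono (A.ball_subset c)).sub_const 1).div_const _).sub
        ((((A.q_diff _ ν mν).mono (A.ball_subset c)).sub_const 1).div_const _)
  intro z₀ w hw
  calc ‖A.quot z₀ μ w - A.quot z₀ ν w‖
      = ‖((A.quot z₀ μ w - A.quot z₀ ν w) - d w) + (d w - d 0) + d 0‖ := by ring_nf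
    _ ≤ K₂ * (‖μ - μ₀‖ + ‖ν - μ₀‖) + K * (K₂ * (‖μ - μ₀‖ + ‖ν - μ₀‖)) + ‖d 0‖ :=
      (norm_add_le _ _).trans (add_le_add ((norm_add_le _ _).trans
        (add_le_add (hd z₀ w hw) (hdd w))) le_rfl)
    _ = _ := by
      change _ + ‖A.quot 0 μ 0 - A.quot 0 ν 0‖ = _
      ring

/-- The limit is joint in the parameter and the point: the uniform Cauchy estimate handles the
parameter, and continuity of a single quotient handles the point. -/
theorem exists_tendsto_quot {R : ℝ} (hR : ∀ z : ℂ, ∃ l ∈ Γ, ‖z + l‖ ≤ R) (z₀ : ℂ) :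
    ∃ k, Tendsto (fun p : ℂ × ℂ => A.quot z₀ p.1 p.2) (𝓝[≠] μ₀ ×ˢ 𝓝 z₀) (𝓝 k) := by
  obtain ⟨K, hK, hev⟩ := A.exists_quot_bound h1 hR
  obtain ⟨k₀, hk₀⟩ : ∃ k₀, Tendsto (fun μ => A.quot 0 μ 0) (𝓝[≠] μ₀) (𝓝 k₀) := by
    refine ⟨_, (hasDerivAt_iff_tendsto_slope.1 A.base_diff.hasDerivAt).congr fun μ => ?_⟩
    rw [slope_def_field, h1 _ _ (A.ball_subset 0 (mem_ball_self A.r_pos)), quot]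
  apply cauchy_map_iff_exists_tendsto.1
  rw [Metric.cauchy_iff]
  refine ⟨inferInstance, fun ε hε => ?_⟩
  have hball : ball μ₀ A.ρ ∈ 𝓝[≠] μ₀ := mem_nhdsWithin_of_mem_nhds (ball_mem_nhds _ A.ρ_pos)
  have hsm : ∀ᶠ μ in 𝓝[≠] μ₀, K * ‖μ - μ₀‖ < ε / 16 := by
    have : Tendsto (fun μ => K * ‖μ - μ₀‖) (𝓝[≠] μ₀) (𝓝 (K * ‖μ₀ - μ₀‖)) :=
      ((continuous_const.mul (continuous_id.sub continuous_const).norm).tendsto μ₀).mono_left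
        nhdsWithin_le_nhds
    exact this.eventually_lt_const (by simp; positivity)
  have hk : ∀ᶠ μ in 𝓝[≠] μ₀, dist (A.quot 0 μ 0) k₀ < ε / 16 :=
    hk₀ (ball_mem_nhds _ (by positivity))
  -- A reference parameter: all values nearby are compared with `quot z₀ ξ z₀`. Five errors of size
  -- `ε / 16` stay below `ε / 2`.
  obtain ⟨ξ, hξ, hξs, hξk, hξρ⟩ := (hev.and (hsm.and (hk.and hball))).exists
  have hc : ContinuousAt (fun w => A.quot z₀ ξ w) z₀ :=
    (((((A.q_diff _ ξ hξρ).mono (A.ball_subset z₀)).sub_const 1).div_const _).differentiableAt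
      (ball_mem_nhds _ A.r_pos)).continuousAt
  have hcw : ∀ᶠ w in 𝓝 z₀, dist (A.quot z₀ ξ w) (A.quot z₀ ξ z₀) < ε / 16 :=
    hc (ball_mem_nhds _ (by positivity))
  refine ⟨_, image_mem_map (prod_mem_prod (inter_mem hξ (inter_mem hsm hk))
    (inter_mem hcw (ball_mem_nhds z₀ A.r_pos))), ?_⟩
  have key : ∀ p ∈ (({ν | ∀ z₀, ∀ w ∈ ball z₀ A.r, ‖A.quot z₀ ξ w - A.quot z₀ ν w‖ ≤
      K * (‖ξ - μ₀‖ + ‖ν - μ₀‖) + ‖A.quot 0 ξ 0 - A.quot 0 ν 0‖} ∩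
      ({μ | K * ‖μ - μ₀‖ < ε / 16} ∩ {μ | dist (A.quot 0 μ 0) k₀ < ε / 16})) ×ˢ
      ({w | dist (A.quot z₀ ξ w) (A.quot z₀ ξ z₀) < ε / 16} ∩ ball z₀ A.r)),
      dist (A.quot z₀ p.1 p.2) (A.quot z₀ ξ z₀) < ε / 2 := by
    rintro ⟨ν, w⟩ ⟨⟨n1, n2, n3⟩, n4, n5⟩
    have n1' : dist (A.quot z₀ ξ w) (A.quot z₀ ν w) ≤ K * (‖ξ - μ₀‖ + ‖ν - μ₀‖) +
        dist (A.quot 0 ξ 0) (A.quot 0 ν 0) := by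
      simpa only [dist_eq_norm] using n1 z₀ w n5
    have n6 := dist_triangle_right (A.quot 0 ξ 0) (A.quot 0 ν 0) k₀
    have n7 := dist_triangle_left (A.quot z₀ ν w) (A.quot z₀ ξ z₀) (A.quot z₀ ξ w)
    change K * ‖ν - μ₀‖ < ε / 16 at n2
    change dist (A.quot 0 ν 0) k₀ < ε / 16 at n3
    change dist (A.quot z₀ ξ w) (A.quot z₀ ξ z₀) < ε / 16 at n4
    change dist (A.quot z₀ ν w) (A.quot z₀ ξ z₀) < ε / 2
    linarith
  rintro _ ⟨p, hp, rfl⟩ _ ⟨p', hp', rfl⟩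
  have := dist_triangle_right (A.quot z₀ p.1 p.2) (A.quot z₀ p'.1 p'.2) (A.quot z₀ ξ z₀)
  have a1 := key p hp
  have a2 := key p' hp'
  linarith

/-- The function is identically 1 for `μ = μ₀`, so its derivative lives in the parameter direction
alone, and the joint limit of the quotients is exactly what Fréchet differentiability requires. -/
theorem differentiableAt_of_normalized {R : ℝ} (hR : ∀ z : ℂ, ∃ l ∈ Γ, ‖z + l‖ ≤ R) (z₀ : ℂ) :
    DifferentiableAt ℂ (fun u : ℂ × ℂ => A.q (A.a z₀) u.1 u.2) (z₀, μ₀) := by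
  obtain ⟨k, hk⟩ := A.exists_tendsto_quot h1 hR z₀
  refine HasFDerivAt.differentiableAt (f' := (ContinuousLinearMap.snd ℂ ℂ ℂ).smulRight k) ?_
  rw [hasFDerivAt_iff_isLittleO, Asymptotics.isLittleO_iff]
  intro c hc
  have hev : ∀ᶠ p in 𝓝[≠] μ₀ ×ˢ 𝓝 z₀, ‖A.quot z₀ p.1 p.2 - k‖ < c := by
    simpa only [dist_eq_norm] using (Metric.tendsto_nhds.1 hk) c hc
  obtain ⟨U, hU, V, hV, hUV⟩ := mem_prod_iff.1 hev
  obtain ⟨U', hU', hUU'⟩ := mem_nhdsWithin_iff_exists_mem_nhds_inter.1 hU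
  have hz := h1 _ _ (A.ball_subset z₀ (mem_ball_self A.r_pos))
  filter_upwards [prod_mem_nhds (inter_mem hV (ball_mem_nhds z₀ A.r_pos)) hU'] with u hu
  simp only [hz]
  rcases eq_or_ne u.2 μ₀ with he | hne
  · rw [he, h1 _ _ (A.ball_subset z₀ hu.1.2)]
    simp [he]
    positivity
  · have hs : u.2 - μ₀ ≠ 0 := sub_ne_zero.2 hne
    have hb : ‖A.quot z₀ u.2 u.1 - k‖ < c := hUV (mk_mem_prod (hUU' ⟨hu.2, hne⟩) hu.1.1)
    have e : A.q (A.a z₀) u.1 u.2 - 1 - ((ContinuousLinearMap.snd ℂ ℂ ℂ).smulRight k)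
        (u - (z₀, μ₀)) = (A.quot z₀ u.2 u.1 - k) * (u.2 - μ₀) := by
      simp only [quot, ContinuousLinearMap.smulRight_apply, ContinuousLinearMap.coe_snd',
        Prod.snd_sub, smul_eq_mul]
      field_simp
    rw [e, norm_mul]
    exact mul_le_mul hb.le (norm_snd_le (u - (z₀, μ₀))) (norm_nonneg _) hc.le

end Normalized

/-- The family of local expressions divided by their values at `μ₀`. -/
def normalize : SliceFamily Γ μ₀ T where
  C := A.C
  a := A.a
  r := A.r
  ρ := A.ρ
  B := A.B * A.B
  r_pos := A.r_pos
  ρ_pos := A.ρ_pos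
  q t z μ := A.q t z μ / A.q t z μ₀
  ball_subset := A.ball_subset
  a_add := A.a_add
  q_add l hl t z μ := by simp only [A.q_add l hl]
  q_diff t μ hμ := (A.q_diff t μ hμ).div (A.q_diff t μ₀ (mem_ball_self A.ρ_pos))
    fun z hz => A.q_ne t z hz μ₀ (mem_ball_self A.ρ_pos)
  q_ne t z hz μ hμ := div_ne_zero (A.q_ne t z hz μ hμ) (A.q_ne t z hz μ₀ (mem_ball_self A.ρ_pos))
  ratio_diff s t z hz := by
    simp only [div_div_div_comm _ _ (A.q t z _)]
    exact (A.ratio_diff s t z hz).div_const _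
  ratio_le s t z hz μ hμ := by
    have h1 := A.ratio_le s t z hz μ hμ
    -- The ratio at `μ₀` enters inverted, that is, with `s` and `t` exchanged; hence the bound `B *
    -- B`.
    have h2 := A.ratio_le t s z hz.symm μ₀ (mem_ball_self A.ρ_pos)
    rw [div_div_div_comm, div_eq_mul_inv, inv_div, norm_mul]
    exact mul_le_mul h1 h2 (norm_nonneg _) ((norm_nonneg _).trans h1)
  base_diff := A.base_diff.div_const _

/-- The divisor used for normalization depends on `z` only and is holomorphic in it, so multiplying
it back preserves differentiability. -/
theorem differentiableAt {R : ℝ} (hR : ∀ z : ℂ, ∃ l ∈ Γ, ‖z + l‖ ≤ R) (z₀ : ℂ) :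
    DifferentiableAt ℂ (fun u : ℂ × ℂ => A.q (A.a z₀) u.1 u.2) (z₀, μ₀) := by
  have h0 := mem_ball_self (x := μ₀) A.ρ_pos
  have h := A.normalize.differentiableAt_of_normalized
    (fun t z hz => div_self (A.q_ne t z hz μ₀ h0)) hR z₀
  have hb := ball_mem_nhds z₀ A.r_pos
  have hq : DifferentiableAt ℂ (fun u : ℂ × ℂ => A.q (A.a z₀) u.1 μ₀) (z₀, μ₀) :=
    DifferentiableAt.comp (g := fun z => A.q (A.a z₀) z μ₀) (z₀, μ₀)
      (((A.q_diff _ μ₀ h0).mono (A.ball_subset z₀)).differentiableAt hb) differentiableAt_fst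
  refine (h.mul hq).congr_of_eventuallyEq ?_
  filter_upwards [prod_mem_nhds hb univ_mem] with u hu
  exact (div_mul_cancel₀ _ (A.q_ne _ _ (A.ball_subset z₀ hu.1) μ₀ h0)).symm

end SliceFamily

end Family

/-! ### Holomorphic functions on tori and their lifts -/

section Projection

variable {Γ Γ₁ Γ₂ : AddSubgroup ℂ} [DiscreteTopology Γ] [DiscreteTopology Γ₁] [DiscreteTopology Γ₂]

theorem mdifferentiable_mk :
    MDifferentiable 𝓘(ℂ, ℂ) 𝓘(ℂ, ℂ) (QuotientAddGroup.mk : ℂ → ℂ ⧸ Γ) := by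
  intro w
  have he : (isLocalHomeomorph_mk Γ).localInverseAt (x := w) ∈ atlas ℂ (ℂ ⧸ Γ) := ⟨w, rfl⟩
  have hs : ⇑((isLocalHomeomorph_mk Γ).localInverseAt (x := w)).symm = QuotientAddGroup.mk :=
    funext fun z => chart_symm he z
  rw [← hs]
  refine (mdifferentiableOn_atlas_symm (I := 𝓘(ℂ, ℂ)) he).mdifferentiableAt ?_
  refine ((isLocalHomeomorph_mk Γ).localInverseAt (x := w)).open_target.mem_nhds ?_
  have h := (isLocalHomeomorph_mk Γ).localInverseAt_apply_self (x := w)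
  have := ((isLocalHomeomorph_mk Γ).localInverseAt (x := w)).map_source
    ((isLocalHomeomorph_mk Γ).apply_self_mem_localInverseAt_source (x := w))
  rwa [h] at this

/-- A function on a torus is holomorphic as soon as its lift is. -/
theorem mdifferentiableAt_of_lift_one {g : ℂ ⧸ Γ → ℂ} {z : ℂ}
    (h : DifferentiableAt ℂ (fun w : ℂ => g (QuotientAddGroup.mk w)) z) :
    MDifferentiableAt 𝓘(ℂ, ℂ) 𝓘(ℂ, ℂ) g (QuotientAddGroup.mk z) := by
  set c := (isLocalHomeomorph_mk Γ).localInverseAt (x := z)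
  have hc : c ∈ atlas ℂ (ℂ ⧸ Γ) := ⟨z, rfl⟩
  have hs : (QuotientAddGroup.mk z : ℂ ⧸ Γ) ∈ c.source :=
    (isLocalHomeomorph_mk Γ).apply_self_mem_localInverseAt_source
  have hz : c (QuotientAddGroup.mk z) = z := (isLocalHomeomorph_mk Γ).localInverseAt_apply_self
  have h1 : MDifferentiableAt 𝓘(ℂ, ℂ) 𝓘(ℂ, ℂ) c (QuotientAddGroup.mk z) :=
    mdifferentiableAt_atlas (I := 𝓘(ℂ, ℂ)) hc hs
  rw [← hz] at h
  refine (h.mdifferentiableAt.comp (QuotientAddGroup.mk z) h1).congr_of_eventuallyEq ?_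
  filter_upwards [c.open_source.mem_nhds hs] with q hq
  simp only [Function.comp, mk_chart hc hq]

/-- A function on a product of two tori is holomorphic as soon as its lift is. -/
theorem mdifferentiableAt_of_lift {g : (ℂ ⧸ Γ₁) × (ℂ ⧸ Γ₂) → ℂ} {u : ℂ × ℂ}
    (h : DifferentiableAt ℂ
      (fun w : ℂ × ℂ => g (QuotientAddGroup.mk w.1, QuotientAddGroup.mk w.2)) u) :
    MDifferentiableAt (𝓘(ℂ, ℂ).prod 𝓘(ℂ, ℂ)) 𝓘(ℂ, ℂ) g
      (QuotientAddGroup.mk u.1, QuotientAddGroup.mk u.2) := by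
  set c₁ := (isLocalHomeomorph_mk Γ₁).localInverseAt (x := u.1)
  set c₂ := (isLocalHomeomorph_mk Γ₂).localInverseAt (x := u.2)
  have hc₁ : c₁ ∈ atlas ℂ (ℂ ⧸ Γ₁) := ⟨u.1, rfl⟩
  have hc₂ : c₂ ∈ atlas ℂ (ℂ ⧸ Γ₂) := ⟨u.2, rfl⟩
  have hs₁ : (QuotientAddGroup.mk u.1 : ℂ ⧸ Γ₁) ∈ c₁.source :=
    (isLocalHomeomorph_mk Γ₁).apply_self_mem_localInverseAt_source
  have hs₂ : (QuotientAddGroup.mk u.2 : ℂ ⧸ Γ₂) ∈ c₂.source :=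
    (isLocalHomeomorph_mk Γ₂).apply_self_mem_localInverseAt_source
  have hz₁ : c₁ (QuotientAddGroup.mk u.1) = u.1 :=
    (isLocalHomeomorph_mk Γ₁).localInverseAt_apply_self
  have hz₂ : c₂ (QuotientAddGroup.mk u.2) = u.2 :=
    (isLocalHomeomorph_mk Γ₂).localInverseAt_apply_self
  set p : (ℂ ⧸ Γ₁) × (ℂ ⧸ Γ₂) := (QuotientAddGroup.mk u.1, QuotientAddGroup.mk u.2)
  have h1 : MDifferentiableAt (𝓘(ℂ, ℂ).prod 𝓘(ℂ, ℂ)) 𝓘(ℂ, ℂ × ℂ)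
      (fun q : (ℂ ⧸ Γ₁) × (ℂ ⧸ Γ₂) => (c₁ q.1, c₂ q.2)) p := by
    apply MDifferentiableAt.prodMk_space
    · exact (mdifferentiableAt_atlas (I := 𝓘(ℂ, ℂ)) hc₁ hs₁).comp p mdifferentiableAt_fst
    · exact (mdifferentiableAt_atlas (I := 𝓘(ℂ, ℂ)) hc₂ hs₂).comp p mdifferentiableAt_snd
  have hu : u = (c₁ p.1, c₂ p.2) := by
    ext
    exacts [hz₁.symm, hz₂.symm]
  rw [hu] at h
  refine (h.mdifferentiableAt.comp p h1).congr_of_eventuallyEq ?_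
  filter_upwards [prod_mem_nhds (c₁.open_source.mem_nhds hs₁) (c₂.open_source.mem_nhds hs₂)]
    with q hq
  simp only [Function.comp, mk_chart hc₁ hq.1, mk_chart hc₂ hq.2]

end Projection

/-! ### Coefficients of isomorphisms of line bundles -/

section LineBundle

variable {B : Type*} [TopologicalSpace B] {E E' : B → Type*}
  [∀ p, AddCommMonoid (E p)] [∀ p, Module ℂ (E p)] [TopologicalSpace (TotalSpace ℂ E)]
  [∀ p, TopologicalSpace (E p)] [FiberBundle ℂ E] [VectorBundle ℂ ℂ E]
  [∀ p, AddCommMonoid (E' p)] [∀ p, Module ℂ (E' p)] [TopologicalSpace (TotalSpace ℂ E')]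
  [∀ p, TopologicalSpace (E' p)] [FiberBundle ℂ E'] [VectorBundle ℂ ℂ E']

theorem triv_smul (e : Trivialization ℂ (π ℂ E)) [MemTrivializationAtlas e] {p : B}
    (hp : p ∈ e.baseSet) (c : ℂ) (v : E p) : (e ⟨p, c • v⟩).2 = c * (e ⟨p, v⟩).2 :=
  (e.linear ℂ hp).2 c v

theorem triv_ne_zero (e : Trivialization ℂ (π ℂ E)) [MemTrivializationAtlas e] {p : B}
    (hp : p ∈ e.baseSet) {v : E p} (hv : v ≠ 0) : (e ⟨p, v⟩).2 ≠ 0 := fun h => by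
  apply hv
  have h0 := (e.linearEquivAt ℂ p hp).map_eq_zero_iff (x := v)
  exact h0.1 h

theorem triv_div_smul (e : Trivialization ℂ (π ℂ E)) [MemTrivializationAtlas e] {p : B}
    (hp : p ∈ e.baseSet) {v : E p} (hv : v ≠ 0) (w : E p) :
    ((e ⟨p, w⟩).2 / (e ⟨p, v⟩).2) • v = w := by
  apply (e.linearEquivAt ℂ p hp).injective
  change (e ⟨p, _⟩).2 = (e ⟨p, _⟩).2
  rw [triv_smul e hp, div_mul_cancel₀ _ (triv_ne_zero e hp hv)]

theorem exists_fiber_ne_zero (p : B) : ∃ v : E p, v ≠ 0 := by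
  have hp := mem_baseSet_trivializationAt ℂ E p
  refine ⟨((trivializationAt ℂ E p).linearEquivAt ℂ p hp).symm 1, fun h => ?_⟩
  exact one_ne_zero (((trivializationAt ℂ E p).linearEquivAt ℂ p hp).symm.map_eq_zero_iff.1 h)

/-- Nonzero vectors in two one-dimensional fibres correspond to each other under an
isomorphism. -/
theorem exists_fiber_equiv {p : B} {v : E p} {w : E' p} (hv : v ≠ 0) (hw : w ≠ 0) :
    ∃ ψ : E p ≃ₗ[ℂ] E' p, ψ v = w := by
  have hp := mem_baseSet_trivializationAt ℂ E p
  have hp' := mem_baseSet_trivializationAt ℂ E' p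
  set φ := (trivializationAt ℂ E p).linearEquivAt ℂ p hp
  set φ' := (trivializationAt ℂ E' p).linearEquivAt ℂ p hp'
  have h1 : φ v ≠ 0 := fun h => hv (φ.map_eq_zero_iff.1 h)
  have h2 : φ' w ≠ 0 := fun h => hw (φ'.map_eq_zero_iff.1 h)
  refine ⟨(φ.trans (LinearEquiv.smulOfNeZero ℂ ℂ _ (div_ne_zero h2 h1))).trans φ'.symm, ?_⟩
  apply φ'.injective
  simp [h1]

/-- The matrix of a fibrewise isomorphism of line bundles in local trivializations. -/
def isoCoord (Ψ : ∀ p, E p ≃ₗ[ℂ] E' p) (e : Trivialization ℂ (π ℂ E))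
    (e' : Trivialization ℂ (π ℂ E')) (p : B) : ℂ :=
  (e' ⟨p, Ψ p (e.symm p 1)⟩).2

variable (Ψ : ∀ p, E p ≃ₗ[ℂ] E' p) (e e₁ : Trivialization ℂ (π ℂ E)) [MemTrivializationAtlas e]
  [MemTrivializationAtlas e₁]
  (e' e₁' : Trivialization ℂ (π ℂ E')) [MemTrivializationAtlas e'] [MemTrivializationAtlas e₁']

theorem isoCoord_mul {p : B} (hp : p ∈ e.baseSet) (hp' : p ∈ e'.baseSet) (v : E p) :
    (e' ⟨p, Ψ p v⟩).2 = isoCoord Ψ e e' p * (e ⟨p, v⟩).2 := by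
  have h : v = (e ⟨p, v⟩).2 • e.symm p 1 := by
    conv_lhs => rw [← e.symm_apply_apply_mk hp v]
    have := (e.symmₗ ℂ p).map_smul (e ⟨p, v⟩).2 (1 : ℂ)
    rwa [smul_eq_mul, mul_one, e.symmₗ_apply hp, e.symmₗ_apply hp] at this
  rw [isoCoord, mul_comm, ← triv_smul e' hp', ← map_smul, ← h]

theorem isoCoord_eq_div {p : B} (hp : p ∈ e.baseSet) (hp' : p ∈ e'.baseSet) {v : E p}
    (hv : v ≠ 0) : isoCoord Ψ e e' p = (e' ⟨p, Ψ p v⟩).2 / (e ⟨p, v⟩).2 := by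
  rw [isoCoord_mul Ψ e e' hp hp', mul_div_cancel_right₀ _ (triv_ne_zero e hp hv)]

theorem isoCoord_ne_zero {p : B} (hp : p ∈ e.baseSet) (hp' : p ∈ e'.baseSet) :
    isoCoord Ψ e e' p ≠ 0 := by
  obtain ⟨v, hv⟩ := exists_fiber_ne_zero (E := E) p
  rw [isoCoord_eq_div Ψ e e' hp hp' hv]
  exact div_ne_zero (triv_ne_zero e' hp' fun h => hv ((Ψ p).map_eq_zero_iff.1 h))
    (triv_ne_zero e hp hv)

theorem coordChange_one {p : B} (hp : p ∈ e.baseSet) (hp₁ : p ∈ e₁.baseSet) {v : E p}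
    (hv : v ≠ 0) : e.coordChange e₁ p 1 = (e₁ ⟨p, v⟩).2 / (e ⟨p, v⟩).2 := by
  have h1 := e.coordChange_apply_snd e₁ (p := ⟨p, v⟩) hp
  have h2 : e.coordChange e₁ p (e ⟨p, v⟩).2 = (e ⟨p, v⟩).2 * e.coordChange e₁ p 1 := by
    have hL : ∀ c, e.coordChangeL ℂ e₁ p c = e.coordChange e₁ p c :=
      fun c => e.coordChangeL_apply' e₁ ⟨hp, hp₁⟩ c
    rw [← hL, ← hL, ← smul_eq_mul, ← map_smul, smul_eq_mul, mul_one]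
  rw [eq_div_iff (triv_ne_zero e hp hv), mul_comm, ← h2, h1]

/-- The isomorphism cancels: the ratio involves only coordinate changes of the two bundles. It is
therefore controlled even when nothing is known about the regularity of `Ψ`. -/
theorem isoCoord_div {p : B} (hp : p ∈ e.baseSet) (hp' : p ∈ e'.baseSet) (hp₁ : p ∈ e₁.baseSet)
    (hp₁' : p ∈ e₁'.baseSet) : isoCoord Ψ e e' p / isoCoord Ψ e₁ e₁' p =
      e₁'.coordChange e' p 1 * e.coordChange e₁ p 1 := by
  obtain ⟨v, hv⟩ := exists_fiber_ne_zero (E := E) p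
  have hv' : Ψ p v ≠ 0 := fun h => hv ((Ψ p).map_eq_zero_iff.1 h)
  rw [isoCoord_eq_div Ψ e e' hp hp' hv, isoCoord_eq_div Ψ e₁ e₁' hp₁ hp₁' hv,
    coordChange_one e e₁ hp hp₁ hv, coordChange_one e₁' e' hp₁' hp' hv']
  have h1 := triv_ne_zero e hp hv
  have h2 := triv_ne_zero e₁ hp₁ hv
  have h3 := triv_ne_zero e₁' hp₁' hv'
  field_simp

end LineBundle

/-! ### Holomorphy along slices implies joint holomorphy -/

section FamilyOfBundles

open Metric Set

variable {Γ₁ Γ₂ : AddSubgroup ℂ} [DiscreteTopology Γ₁] [DiscreteTopology Γ₂]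
  {E E' : (ℂ ⧸ Γ₁) × (ℂ ⧸ Γ₂) → Type*}
  [∀ p, AddCommMonoid (E p)] [∀ p, Module ℂ (E p)] [TopologicalSpace (TotalSpace ℂ E)]
  [∀ p, TopologicalSpace (E p)] [FiberBundle ℂ E] [VectorBundle ℂ ℂ E]
  [ContMDiffVectorBundle 1 ℂ E (𝓘(ℂ, ℂ).prod 𝓘(ℂ, ℂ))]
  [∀ p, AddCommMonoid (E' p)] [∀ p, Module ℂ (E' p)] [TopologicalSpace (TotalSpace ℂ E')]
  [∀ p, TopologicalSpace (E' p)] [FiberBundle ℂ E'] [VectorBundle ℂ ℂ E']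
  [ContMDiffVectorBundle 1 ℂ E' (𝓘(ℂ, ℂ).prod 𝓘(ℂ, ℂ))]

/-- `Ψ` is holomorphic along the curve `f`: it sends some nowhere vanishing holomorphic section
along `f` to a holomorphic section. -/
def HolAlong (Ψ : ∀ p, E p ≃ₗ[ℂ] E' p) (f : ℂ → (ℂ ⧸ Γ₁) × (ℂ ⧸ Γ₂)) : Prop :=
  ∃ s : ∀ z, E (f z), (∀ z, s z ≠ 0) ∧
    MDifferentiable 𝓘(ℂ, ℂ) ((𝓘(ℂ, ℂ).prod 𝓘(ℂ, ℂ)).prod 𝓘(ℂ, ℂ))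
      (fun z => TotalSpace.mk' ℂ (E := E) (f z) (s z)) ∧
    MDifferentiable 𝓘(ℂ, ℂ) ((𝓘(ℂ, ℂ).prod 𝓘(ℂ, ℂ)).prod 𝓘(ℂ, ℂ))
      (fun z => TotalSpace.mk' ℂ (E := E') (f z) (Ψ (f z) (s z)))

variable (e e₁ : Trivialization ℂ (π ℂ E)) [MemTrivializationAtlas e] [MemTrivializationAtlas e₁]
  (e' e₁' : Trivialization ℂ (π ℂ E')) [MemTrivializationAtlas e'] [MemTrivializationAtlas e₁']

theorem HolAlong.differentiableAt {Ψ : ∀ p, E p ≃ₗ[ℂ] E' p} {f : ℂ → (ℂ ⧸ Γ₁) × (ℂ ⧸ Γ₂)}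
    (h : HolAlong Ψ f) (hf : Continuous f) {z : ℂ} (hz : f z ∈ e.baseSet) (hz' : f z ∈ e'.baseSet) :
    DifferentiableAt ℂ (fun w => isoCoord Ψ e e' (f w)) z := by
  obtain ⟨s, hs, h1, h2⟩ := h
  have d1 := ((e.mdifferentiableAt_totalSpace_iff (𝓘(ℂ, ℂ).prod 𝓘(ℂ, ℂ)) _
    (e.mem_source.2 hz)).1 (h1 z)).2.differentiableAt
  have d2 := ((e'.mdifferentiableAt_totalSpace_iff (𝓘(ℂ, ℂ).prod 𝓘(ℂ, ℂ)) _
    (e'.mem_source.2 hz')).1 (h2 z)).2.differentiableAt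
  refine (d2.div d1 (triv_ne_zero e hz (hs z))).congr_of_eventuallyEq ?_
  filter_upwards [hf.continuousAt.preimage_mem_nhds (e.open_baseSet.mem_nhds hz),
    hf.continuousAt.preimage_mem_nhds (e'.open_baseSet.mem_nhds hz')] with w hw hw'
  exact isoCoord_eq_div Ψ e e' hw hw' (hs w)

/-- The total map of a fibrewise isomorphism is holomorphic where its matrix is. -/
theorem mdifferentiableAt_total {Ψ : ∀ p, E p ≃ₗ[ℂ] E' p} {v : TotalSpace ℂ E}
    (hv : v.1 ∈ e.baseSet) (hv' : v.1 ∈ e'.baseSet)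
    (h : MDifferentiableAt (𝓘(ℂ, ℂ).prod 𝓘(ℂ, ℂ)) 𝓘(ℂ, ℂ) (isoCoord Ψ e e') v.1) :
    MDifferentiableAt ((𝓘(ℂ, ℂ).prod 𝓘(ℂ, ℂ)).prod 𝓘(ℂ, ℂ))
      ((𝓘(ℂ, ℂ).prod 𝓘(ℂ, ℂ)).prod 𝓘(ℂ, ℂ))
      (fun v : TotalSpace ℂ E => TotalSpace.mk' ℂ (E := E') v.1 (Ψ v.1 v.2)) v := by
  have hp : MDifferentiableAt ((𝓘(ℂ, ℂ).prod 𝓘(ℂ, ℂ)).prod 𝓘(ℂ, ℂ)) (𝓘(ℂ, ℂ).prod 𝓘(ℂ, ℂ))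
    (π ℂ E) v := mdifferentiableAt_proj E
  rw [e'.mdifferentiableAt_totalSpace_iff (𝓘(ℂ, ℂ).prod 𝓘(ℂ, ℂ)) _ (e'.mem_source.2 hv')]
  refine ⟨hp, ?_⟩
  have h1 := ((e.mdifferentiableAt_totalSpace_iff (𝓘(ℂ, ℂ).prod 𝓘(ℂ, ℂ)) id
    (e.mem_source.2 hv)).1 (mdifferentiableAt_id (x := v))).2
  have h2 := (h.comp v hp).mul h1
  refine h2.congr_of_eventuallyEq ?_
  filter_upwards [hp.continuousAt.preimage_mem_nhds (e.open_baseSet.mem_nhds hv),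
    hp.continuousAt.preimage_mem_nhds (e'.open_baseSet.mem_nhds hv')] with w hw hw'
  exact isoCoord_mul Ψ e e' hw hw' w.2

/-- The transition function between the matrices of an isomorphism in different
trivializations. -/
theorem mdifferentiableOn_transition :
    MDifferentiableOn (𝓘(ℂ, ℂ).prod 𝓘(ℂ, ℂ)) 𝓘(ℂ, ℂ)
      (fun p => e₁'.coordChange e' p 1 * e.coordChange e₁ p 1)
      ((e.baseSet ∩ e'.baseSet) ∩ (e₁.baseSet ∩ e₁'.baseSet)) := by
  refine MDifferentiableOn.mul ?_ ?_
  · exact MDifferentiableOn.coordChange mdifferentiableOn_id mdifferentiableOn_const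
      (fun p hp => hp.2.2) fun p hp => hp.1.2
  · exact MDifferentiableOn.coordChange mdifferentiableOn_id mdifferentiableOn_const
      (fun p hp => hp.1.1) fun p hp => hp.2.1

omit [DiscreteTopology Γ₁] in
-- A Lebesgue number on a compact disc meeting every coset works on all of `ℂ` after translation.
-- The index is chosen on the quotient, so that the choice is periodic upstairs.
theorem exists_lebesgue {T : Type*} {R : ℝ} (hR : ∀ z : ℂ, ∃ l ∈ Γ₁, ‖z + l‖ ≤ R)
    {c : T → Set (ℂ ⧸ Γ₁)} (hc : ∀ t, IsOpen (c t)) (hcov : ∀ x, ∃ t, x ∈ c t) :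
    ∃ r > 0, ∃ a : ℂ ⧸ Γ₁ → T, ∀ z : ℂ, ∀ w ∈ ball z r,
      (QuotientAddGroup.mk w : ℂ ⧸ Γ₁) ∈ c (a (QuotientAddGroup.mk z)) := by
  obtain ⟨r, hr, hL⟩ := lebesgue_number_lemma_of_metric (isCompact_closedBall (0 : ℂ) R)
    (c := fun t => (QuotientAddGroup.mk : ℂ → ℂ ⧸ Γ₁) ⁻¹' c t)
    (fun t => (hc t).preimage QuotientAddGroup.continuous_mk)
    (fun z _ => mem_iUnion.2 (hcov _))
  have ha : ∀ x : ℂ ⧸ Γ₁, ∃ t, ∀ z : ℂ, QuotientAddGroup.mk z = x → ∀ w ∈ ball z r,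
      (QuotientAddGroup.mk w : ℂ ⧸ Γ₁) ∈ c t := by
    intro x
    obtain ⟨z₀, rfl⟩ := QuotientAddGroup.mk_surjective x
    obtain ⟨l, hl, hle⟩ := hR z₀
    obtain ⟨t, ht⟩ := hL (z₀ + l) (by simpa using hle)
    refine ⟨t, fun z hz w hw => ?_⟩
    have hz' : -z + z₀ ∈ Γ₁ := QuotientAddGroup.eq.1 hz
    have hw' : (QuotientAddGroup.mk (w + ((-z + z₀) + l)) : ℂ ⧸ Γ₁) ∈ c t := by
      refine ht ?_
      rw [mem_ball, dist_eq_norm] at hw ⊢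
      convert hw using 2
      ring
    have e : (QuotientAddGroup.mk (w + ((-z + z₀) + l)) : ℂ ⧸ Γ₁) = QuotientAddGroup.mk w := by
      refine (QuotientAddGroup.eq.2 ?_).symm
      rw [neg_add_cancel_left]
      exact add_mem hz' hl
    rwa [e] at hw'
  choose a ha using ha
  exact ⟨r, hr, a, fun z w hw => ha _ z rfl w hw⟩

omit [DiscreteTopology Γ₂] in
/-- Compact sets that cover `ℂ ⧸ Γ₁` and lie in the slices of given open sets, uniformly over a
disc in the second factor. -/
theorem exists_finite_cover [CompactSpace (ℂ ⧸ Γ₁)] (μ₀ : ℂ)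
    {U : ℂ ⧸ Γ₁ → Set ((ℂ ⧸ Γ₁) × (ℂ ⧸ Γ₂))} (hU : ∀ x, IsOpen (U x))
    (hxU : ∀ x, (x, (QuotientAddGroup.mk μ₀ : ℂ ⧸ Γ₂)) ∈ U x) :
    ∃ (T : Finset (ℂ ⧸ Γ₁)) (k : ℂ ⧸ Γ₁ → Set (ℂ ⧸ Γ₁)) (ρ : ℝ), 0 < ρ ∧
      (∀ x, IsCompact (k x)) ∧ (∀ x, ∃ t ∈ T, x ∈ interior (k t)) ∧
      ∀ t ∈ T, ∀ x ∈ k t, ∀ μ ∈ closedBall μ₀ ρ, (x, (QuotientAddGroup.mk μ : ℂ ⧸ Γ₂)) ∈ U t := by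
  have : LocallyCompactSpace (ℂ ⧸ Γ₁) := ChartedSpace.locallyCompactSpace ℂ _
  have h : ∀ x, ∃ k : Set (ℂ ⧸ Γ₁), ∃ ρ : ℝ, 0 < ρ ∧ IsCompact k ∧ k ∈ 𝓝 x ∧ ∀ y ∈ k,
      ∀ μ ∈ closedBall μ₀ ρ, (y, (QuotientAddGroup.mk μ : ℂ ⧸ Γ₂)) ∈ U x := by
    intro x
    obtain ⟨V, hV, W, hW, hVW⟩ := mem_nhds_prod_iff.1 ((hU x).mem_nhds (hxU x))
    obtain ⟨k, hk, hkV, hkc⟩ := local_compact_nhds hV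
    obtain ⟨ρ, hρ, hρW⟩ := nhds_basis_closedBall.mem_iff.1
      (QuotientAddGroup.continuous_mk.continuousAt.preimage_mem_nhds hW)
    exact ⟨k, ρ, hρ, hkc, hk, fun y hy μ hμ => hVW ⟨hkV hy, hρW hμ⟩⟩
  choose k ρ hρ hkc hk hkU using h
  obtain ⟨T, hT⟩ := CompactSpace.elim_nhds_subcover (fun x => interior (k x))
    fun x => interior_mem_nhds.2 (hk x)
  have hcov : ∀ x, ∃ t ∈ T, x ∈ interior (k t) := fun x => by
    have hx : x ∈ ⋃ t ∈ T, interior (k t) := by rw [hT]; trivial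
    simpa using hx
  have hne : T.Nonempty := by
    obtain ⟨t, ht, -⟩ := hcov 0
    exact ⟨t, ht⟩
  refine ⟨T, k, T.inf' hne ρ, (Finset.lt_inf'_iff hne).2 fun t _ => hρ t, hkc, hcov, ?_⟩
  intro t ht x hx μ hμ
  exact hkU t x hx μ (closedBall_subset_closedBall (Finset.inf'_le _ ht) hμ)

variable [CompactSpace (ℂ ⧸ Γ₁)] [T2Space (ℂ ⧸ Γ₁)]

/-- A fibrewise isomorphism of holomorphic line bundles over a product of two tori is holomorphic
if it is holomorphic along the slices `ℂ ⧸ Γ₁ × {y}` and along `{0} × ℂ ⧸ Γ₂`. -/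
theorem mdifferentiable_of_slices {R : ℝ} (hR : ∀ z : ℂ, ∃ l ∈ Γ₁, ‖z + l‖ ≤ R)
    (Ψ : ∀ p, E p ≃ₗ[ℂ] E' p)
    (h1 : ∀ y : ℂ ⧸ Γ₂, HolAlong Ψ fun z => (QuotientAddGroup.mk z, y))
    (h2 : HolAlong Ψ fun μ => (QuotientAddGroup.mk 0, QuotientAddGroup.mk μ)) :
    MDifferentiable ((𝓘(ℂ, ℂ).prod 𝓘(ℂ, ℂ)).prod 𝓘(ℂ, ℂ))
      ((𝓘(ℂ, ℂ).prod 𝓘(ℂ, ℂ)).prod 𝓘(ℂ, ℂ))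
      (fun v : TotalSpace ℂ E => TotalSpace.mk' ℂ (E := E') v.1 (Ψ v.1 v.2)) := by
  rintro ⟨⟨x₀, y₀⟩, v⟩
  obtain ⟨z₀, rfl⟩ := QuotientAddGroup.mk_surjective x₀
  obtain ⟨μ₀, rfl⟩ := QuotientAddGroup.mk_surjective y₀
  let tr : ∀ x : ℂ ⧸ Γ₁, Trivialization ℂ (π ℂ E) := fun x =>
    trivializationAt ℂ E (x, QuotientAddGroup.mk μ₀)
  let tr' : ∀ x : ℂ ⧸ Γ₁, Trivialization ℂ (π ℂ E') := fun x =>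
    trivializationAt ℂ E' (x, QuotientAddGroup.mk μ₀)
  have : ∀ x, MemTrivializationAtlas (tr x) := fun x => by
    dsimp only [tr]; infer_instance
  have : ∀ x, MemTrivializationAtlas (tr' x) := fun x => by
    dsimp only [tr']; infer_instance
  let U := fun x => (tr x).baseSet ∩ (tr' x).baseSet
  have hU : ∀ x, IsOpen (U x) := fun x => (tr x).open_baseSet.inter (tr' x).open_baseSet
  obtain ⟨T, k, ρ, hρ, hk, hcov, hkU⟩ := exists_finite_cover (Γ₂ := Γ₂) μ₀ hU
    fun x => ⟨mem_baseSet_trivializationAt ℂ E _, mem_baseSet_trivializationAt ℂ E' _⟩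
  obtain ⟨r, hr, a, ha⟩ := exists_lebesgue hR (c := fun t : T => interior (k t))
    (fun t => isOpen_interior) fun x => by
      obtain ⟨t, ht, hx⟩ := hcov x
      exact ⟨⟨t, ht⟩, hx⟩
  -- These are the ratios of coefficients by `isoCoord_div`. They are jointly holomorphic, hence
  -- holomorphic in `μ` and bounded on compact sets; `T` is finite, so one bound serves all pairs.
  let κ : T → T → (ℂ ⧸ Γ₁) × (ℂ ⧸ Γ₂) → ℂ := fun s t p =>
    (tr' t).coordChange (tr' s) p 1 * (tr s).coordChange (tr t) p 1
  have hκ : ∀ s t : T, MDifferentiableOn (𝓘(ℂ, ℂ).prod 𝓘(ℂ, ℂ)) 𝓘(ℂ, ℂ) (κ s t)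
      (U s ∩ U t) := fun s t => mdifferentiableOn_transition (tr s) (tr t) (tr' s) (tr' t)
  have hB : ∀ s t : T, ∃ B, ∀ x ∈ k s ∩ k t, ∀ μ ∈ closedBall μ₀ ρ,
      ‖κ s t (x, QuotientAddGroup.mk μ)‖ ≤ B := by
    intro s t
    have hc : IsCompact ((k s ∩ k t) ×ˢ ((QuotientAddGroup.mk : ℂ → ℂ ⧸ Γ₂) '' closedBall μ₀ ρ)) :=
      ((hk s).inter (hk t)).prod
        ((isCompact_closedBall μ₀ ρ).image QuotientAddGroup.continuous_mk)
    obtain ⟨B, hB⟩ := hc.exists_bound_of_continuousOn (f := κ s t)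
      ((hκ s t).continuousOn.mono (by
        rintro ⟨x, _⟩ ⟨hx, μ, hμ, rfl⟩
        exact ⟨hkU s s.2 x hx.1 μ hμ, hkU t t.2 x hx.2 μ hμ⟩))
    exact ⟨B, fun x hx μ hμ => hB (x, QuotientAddGroup.mk μ) ⟨hx, μ, hμ, rfl⟩⟩
  choose Bf hBf using hB
  obtain ⟨B, hBB⟩ : ∃ B, ∀ s t, Bf s t ≤ B := by
    obtain ⟨B, hB⟩ := (Set.finite_range fun p : T × T => Bf p.1 p.2).bddAbove
    exact ⟨B, fun s t => hB ⟨(s, t), rfl⟩⟩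
  have hmem : ∀ (t : T) (z : ℂ), (QuotientAddGroup.mk z : ℂ ⧸ Γ₁) ∈ interior (k t) →
      ∀ μ ∈ ball μ₀ ρ, ((QuotientAddGroup.mk z : ℂ ⧸ Γ₁), (QuotientAddGroup.mk μ : ℂ ⧸ Γ₂)) ∈ U t :=
    fun t z hz μ hμ => hkU t t.2 _ (interior_subset hz) μ (ball_subset_closedBall hμ)
  have hper : ∀ l ∈ Γ₁, ∀ z : ℂ, (QuotientAddGroup.mk (z + l) : ℂ ⧸ Γ₁) = QuotientAddGroup.mk z :=
    fun l hl z => (QuotientAddGroup.eq.2 (by rwa [neg_add_cancel_left])).symm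
  let A : SliceFamily Γ₁ μ₀ T :=
    { C := fun t => {z | (QuotientAddGroup.mk z : ℂ ⧸ Γ₁) ∈ interior (k t)}
      a := fun z => a (QuotientAddGroup.mk z)
      r := r
      ρ := ρ
      B := B
      r_pos := hr
      ρ_pos := hρ
      q := fun t z μ => isoCoord Ψ (tr t) (tr' t) (QuotientAddGroup.mk z, QuotientAddGroup.mk μ)
      ball_subset := ha
      a_add := fun l hl z => by rw [hper l hl]
      q_add := fun l hl t z μ => by rw [hper l hl]
      q_diff := fun t μ hμ z hz => ((h1 (QuotientAddGroup.mk μ)).differentiableAt (tr t) (tr' t)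
        (QuotientAddGroup.continuous_mk.prodMk continuous_const)
        (hmem t z hz μ hμ).1 (hmem t z hz μ hμ).2).differentiableWithinAt
      q_ne := fun t z hz μ hμ => isoCoord_ne_zero Ψ (tr t) (tr' t) (hmem t z hz μ hμ).1
        (hmem t z hz μ hμ).2
      ratio_diff := fun s t z hz μ hμ => by
        have hp := And.intro (hmem s z hz.1 μ hμ) (hmem t z hz.2 μ hμ)
        have d : MDifferentiableAt 𝓘(ℂ, ℂ) 𝓘(ℂ, ℂ)
            (κ s t ∘ fun μ : ℂ => (QuotientAddGroup.mk z, QuotientAddGroup.mk μ)) μ :=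
          (((hκ s t).mdifferentiableAt (((hU s).inter (hU t)).mem_nhds hp)).comp μ
            (mdifferentiableAt_const.prodMk (mdifferentiable_mk μ)))
        have hr : ∀ ν ∈ ball μ₀ ρ, _ / _ = κ s t (QuotientAddGroup.mk z, QuotientAddGroup.mk ν) :=
          fun ν hν => isoCoord_div Ψ (tr s) (tr t) (tr' s) (tr' t) (hmem s z hz.1 ν hν).1
          (hmem s z hz.1 ν hν).2 (hmem t z hz.2 ν hν).1 (hmem t z hz.2 ν hν).2
        exact d.differentiableAt.differentiableWithinAt.congr hr (hr μ hμ)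
      ratio_le := fun s t z hz μ hμ => by
        rw [isoCoord_div Ψ (tr s) (tr t) (tr' s) (tr' t) (hmem s z hz.1 μ hμ).1
          (hmem s z hz.1 μ hμ).2 (hmem t z hz.2 μ hμ).1 (hmem t z hz.2 μ hμ).2]
        exact (hBf s t _ ⟨interior_subset hz.1, interior_subset hz.2⟩ μ
          (ball_subset_closedBall hμ)).trans (hBB s t)
      -- Only here does holomorphy along `{0} × ℂ ⧸ Γ₂` enter.
      base_diff := by
        have hp := hmem (a (QuotientAddGroup.mk 0)) 0 (ha 0 0 (mem_ball_self hr)) μ₀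
          (mem_ball_self hρ)
        exact h2.differentiableAt _ _ (continuous_const.prodMk QuotientAddGroup.continuous_mk)
          hp.1 hp.2 }
  have hd := mdifferentiableAt_of_lift (A.differentiableAt hR z₀)
    (g := isoCoord Ψ (tr (A.a z₀)) (tr' (A.a z₀)))
  have hp := hmem (A.a z₀) z₀ (ha z₀ z₀ (mem_ball_self hr)) μ₀ (mem_ball_self hρ)
  exact mdifferentiableAt_total _ _ hp.1 hp.2 hd

end FamilyOfBundles

/-! ### Compactness of the torus -/

section Lattice

variable (δ : ℕ+) (τ : ℍ)

theorem exists_lattice_close (z : ℂ) : ∃ l ∈ Λ δ τ, ‖z + l‖ ≤ ‖(δ : ℂ)‖ + ‖(τ : ℂ)‖ := by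
  refine ⟨(-⌊dx₁ δ τ z⌋) • (δ : ℂ) + (-⌊dx₂ τ z⌋) • (τ : ℂ),
    AddSubgroup.mem_closure_pair.2 ⟨_, _, rfl⟩, ?_⟩
  have e : z + ((-⌊dx₁ δ τ z⌋) • (δ : ℂ) + (-⌊dx₂ τ z⌋) • (τ : ℂ)) =
      ((Int.fract (dx₁ δ τ z) : ℝ) : ℂ) * δ + ((Int.fract (dx₂ τ z) : ℝ) : ℂ) * τ := by
    simp only [zsmul_eq_mul, Int.fract]
    push_cast
    linear_combination eq_coords δ τ z
  have hf : ∀ x : ℝ, ‖((Int.fract x : ℝ) : ℂ)‖ ≤ 1 := fun x => by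
    rw [Complex.norm_real, Real.norm_of_nonneg (Int.fract_nonneg x)]
    exact (Int.fract_lt_one x).le
  rw [e]
  refine (norm_add_le _ _).trans (add_le_add ?_ ?_) <;> rw [norm_mul] <;>
    exact mul_le_of_le_one_left (norm_nonneg _) (hf _)

instance : CompactSpace (M δ τ) := by
  have h : (QuotientAddGroup.mk : ℂ → M δ τ) '' Metric.closedBall 0 (‖(δ : ℂ)‖ + ‖(τ : ℂ)‖) =
      Set.univ := by
    refine Set.eq_univ_of_forall fun x => ?_
    obtain ⟨z, rfl⟩ := QuotientAddGroup.mk_surjective x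
    obtain ⟨l, hl, hle⟩ := exists_lattice_close δ τ z
    exact ⟨z + l, by simpa using hle, (QuotientAddGroup.eq.2 (by rwa [neg_add_cancel_left])).symm⟩
  exact ⟨h ▸ (isCompact_closedBall _ _).image QuotientAddGroup.continuous_mk⟩

end Lattice

/-! ### Holomorphic sections of pull-back and trivial bundles -/

section Pullback

variable {EB HB EN HN B N : Type*} [NormedAddCommGroup EB] [NormedSpace ℂ EB] [TopologicalSpace HB]
  {I : ModelWithCorners ℂ EB HB} [TopologicalSpace B] [ChartedSpace HB B]
  [NormedAddCommGroup EN] [NormedSpace ℂ EN] [TopologicalSpace HN]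
  {J : ModelWithCorners ℂ EN HN} [TopologicalSpace N] [ChartedSpace HN N]
  {E : B → Type*} [TopologicalSpace (TotalSpace ℂ E)] [∀ x, TopologicalSpace (E x)]
  [FiberBundle ℂ E]
  {EX HX X : Type*} [NormedAddCommGroup EX] [NormedSpace ℂ EX] [TopologicalSpace HX]
  {K : ModelWithCorners ℂ EX HX} [TopologicalSpace X] [ChartedSpace HX X]

/-- The distinguished trivializations of the pull-back are by definition the pulled back ones, so
holomorphy can be tested with those of `E`. -/
theorem mdifferentiableAt_pullback_iff [∀ x, Zero (E x)] (f : ContMDiffMap J I N B ∞)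
    (g : X → TotalSpace ℂ (f *ᵖ E)) {x : X} :
    MDifferentiableAt K (J.prod 𝓘(ℂ, ℂ)) g x ↔
      MDifferentiableAt K J (fun y => (g y).1) x ∧
        MDifferentiableAt K 𝓘(ℂ, ℂ)
          (fun y => (trivializationAt ℂ E (f (g x).1) ⟨f (g y).1, (g y).2⟩).2) x :=
  mdifferentiableAt_totalSpace J g

theorem mdifferentiable_of_pullback [∀ x, Zero (E x)] {f : ContMDiffMap J I N B ∞}
    {g : X → TotalSpace ℂ (f *ᵖ E)} (h : MDifferentiable K (J.prod 𝓘(ℂ, ℂ)) g) :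
    MDifferentiable K (I.prod 𝓘(ℂ, ℂ))
      (fun y => TotalSpace.mk' ℂ (E := E) (f (g y).1) (g y).2) := fun x => by
  have hx := (mdifferentiableAt_pullback_iff f g).1 (h x)
  exact (mdifferentiableAt_totalSpace I _).2
    ⟨((f.contMDiff.mdifferentiable (by simp)) _).comp x hx.1, hx.2⟩

theorem mdifferentiable_smul_section [∀ x, AddCommMonoid (E x)] [∀ x, Module ℂ (E x)]
    [VectorBundle ℂ ℂ E] {f : X → B} {s : ∀ x, E (f x)} (c : ℂ)
    (h : MDifferentiable K (I.prod 𝓘(ℂ, ℂ)) (fun x => TotalSpace.mk' ℂ (E := E) (f x) (s x))) :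
    MDifferentiable K (I.prod 𝓘(ℂ, ℂ)) (fun x => TotalSpace.mk' ℂ (E := E) (f x) (c • s x)) :=
    fun x => by
  have hx := (mdifferentiableAt_totalSpace I _).1 (h x)
  have hx1 : MDifferentiableAt K I f x := hx.1
  refine (mdifferentiableAt_totalSpace I _).2 ⟨hx.1, ?_⟩
  refine ((mdifferentiableAt_const (c := c)).mul hx.2).congr_of_eventuallyEq ?_
  filter_upwards [hx1.continuousAt.preimage_mem_nhds
    ((trivializationAt ℂ E (f x)).open_baseSet.mem_nhds (mem_baseSet_trivializationAt ℂ E (f x)))]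
    with y hy
  exact triv_smul _ hy c (s y)

theorem mdifferentiableAt_trivial_iff {g : X → TotalSpace ℂ (Bundle.Trivial B ℂ)} {x : X} :
    MDifferentiableAt K (I.prod 𝓘(ℂ, ℂ)) g x ↔
      MDifferentiableAt K I (fun y => (g y).1) x ∧
        MDifferentiableAt K 𝓘(ℂ, ℂ) (fun y => ((g y).2 : ℂ)) x :=
  mdifferentiableAt_totalSpace I g

end Pullback

/-! ### Bundles with equal multipliers -/

section Multipliers

variable {Γ : AddSubgroup ℂ} [DiscreteTopology Γ] {E E' : ℂ ⧸ Γ → Type*}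
  [∀ p, AddCommMonoid (E p)] [∀ p, Module ℂ (E p)] [TopologicalSpace (TotalSpace ℂ E)]
  [∀ p, TopologicalSpace (E p)] [FiberBundle ℂ E] [VectorBundle ℂ ℂ E]
  [∀ p, AddCommMonoid (E' p)] [∀ p, Module ℂ (E' p)] [TopologicalSpace (TotalSpace ℂ E')]
  [∀ p, TopologicalSpace (E' p)] [FiberBundle ℂ E'] [VectorBundle ℂ ℂ E']

omit [DiscreteTopology Γ] in
-- Sending `s z` to `c • s' z` is independent of the lift `z`, because both sections change by the
-- same factor under the lattice.
theorem exists_equiv_of_multipliers {e : ℂ → ℂ → ℂ} {s : ∀ z : ℂ, E (QuotientAddGroup.mk z)}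
    {s' : ∀ z : ℂ, E' (QuotientAddGroup.mk z)} (h0 : ∀ z, s z ≠ 0) (h0' : ∀ z, s' z ≠ 0)
    (h : ∀ l ∈ Γ, ∀ z, TotalSpace.mk' ℂ (E := E) (QuotientAddGroup.mk (z + l)) (s (z + l)) =
      TotalSpace.mk' ℂ (QuotientAddGroup.mk z) ((e l z)⁻¹ • s z))
    (h' : ∀ l ∈ Γ, ∀ z, TotalSpace.mk' ℂ (E := E') (QuotientAddGroup.mk (z + l)) (s' (z + l)) =
      TotalSpace.mk' ℂ (QuotientAddGroup.mk z) ((e l z)⁻¹ • s' z)) (c : ℂ) (hc : c ≠ 0) :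
    ∃ Ψ : ∀ x, E x ≃ₗ[ℂ] E' x, ∀ z, Ψ (QuotientAddGroup.mk z) (s z) = c • s' z := by
  -- Fibres over different lifts of `x` agree only propositionally; comparing points of the total
  -- spaces avoids transport.
  have key : ∀ x, ∃ ψ : E x ≃ₗ[ℂ] E' x, ∀ (z : ℂ), QuotientAddGroup.mk z = x → ∀ v : E x,
      TotalSpace.mk' ℂ (E := E) (QuotientAddGroup.mk z) (s z) = TotalSpace.mk' ℂ x v →
      TotalSpace.mk' ℂ (E := E') (QuotientAddGroup.mk z) (c • s' z) =
        TotalSpace.mk' ℂ x (ψ v) := by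
    intro x
    obtain ⟨z₀, rfl⟩ := QuotientAddGroup.mk_surjective x
    have hne : c • s' z₀ ≠ 0 := fun h1 => h0' z₀ (by
      have := congrArg (fun w => c⁻¹ • w) h1
      simpa [smul_smul, inv_mul_cancel₀ hc] using this)
    obtain ⟨ψ, hψ⟩ := exists_fiber_equiv (h0 z₀) hne
    refine ⟨ψ, fun z hz v hv => ?_⟩
    have hl : -z₀ + z ∈ Γ := QuotientAddGroup.eq.1 hz.symm
    have hz' : z = z₀ + (-z₀ + z) := by ring
    rw [hz'] at hv ⊢
    have h1 := congrArg (fun t : TotalSpace ℂ E' => TotalSpace.mk' ℂ (E := E') t.1 (c • t.2))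
      (h' _ hl z₀)
    simp only at h1
    rw [h _ hl z₀] at hv
    have hv' : (e (-z₀ + z) z₀)⁻¹ • s z₀ = v := by
      simpa [TotalSpace.mk', TotalSpace.mk_inj] using hv
    rw [← hv', map_smul, hψ, smul_comm]
    exact h1
  choose Ψ hΨ using key
  refine ⟨Ψ, fun z => ?_⟩
  have := hΨ _ z rfl (s z) rfl
  simpa [TotalSpace.mk', TotalSpace.mk_inj] using this.symm

end Multipliers

/-! ### Uniqueness of the Poincaré bundle -/

section Uniqueness

variable {δ : ℕ+} {τ : ℍ} {P P' : M δ τ × Mhat δ τ → Type*}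
  [∀ p, AddCommMonoid (P p)] [∀ p, Module ℂ (P p)] [TopologicalSpace (TotalSpace ℂ P)]
  [∀ p, TopologicalSpace (P p)] [FiberBundle ℂ P] [VectorBundle ℂ ℂ P]
  [∀ p, AddCommMonoid (P' p)] [∀ p, Module ℂ (P' p)] [TopologicalSpace (TotalSpace ℂ P')]
  [∀ p, TopologicalSpace (P' p)] [FiberBundle ℂ P'] [VectorBundle ℂ ℂ P']

omit [VectorBundle ℂ ℂ P] [VectorBundle ℂ ℂ P'] in
theorem HolAlong.symm {Ψ : ∀ p, P p ≃ₗ[ℂ] P' p} {f : ℂ → M δ τ × Mhat δ τ}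
    (h : HolAlong Ψ f) : HolAlong (fun p => (Ψ p).symm) f := by
  obtain ⟨s, h0, h1, h2⟩ := h
  refine ⟨fun z => Ψ _ (s z), fun z hz => h0 z ((Ψ _).map_eq_zero_iff.1 hz), h2, ?_⟩
  simpa only [LinearEquiv.symm_apply_apply] using h1

/-- A fibrewise isomorphism over one slice `M × {y}` that is holomorphic and is compatible with
given isomorphisms with `ℂ` over the origin. -/
theorem exists_slice_iso {μ : ℂ}
    (h : HasMultipliers (sliceM δ τ (mkMhat δ τ μ) *ᵖ P) (picMultiplier τ μ))
    (h' : HasMultipliers (sliceM δ τ (mkMhat δ τ μ) *ᵖ P') (picMultiplier τ μ))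
    (φ : P (0, mkMhat δ τ μ) ≃ₗ[ℂ] ℂ) (φ' : P' (0, mkMhat δ τ μ) ≃ₗ[ℂ] ℂ) :
    ∃ Ψ : ∀ x, P (x, mkMhat δ τ μ) ≃ₗ[ℂ] P' (x, mkMhat δ τ μ),
      (∀ v, φ' (Ψ 0 v) = φ v) ∧ ∃ s : ∀ z, P (mkM δ τ z, mkMhat δ τ μ), (∀ z, s z ≠ 0) ∧
        MDifferentiable 𝓘(ℂ, ℂ) ((𝓘(ℂ, ℂ).prod 𝓘(ℂ, ℂ)).prod 𝓘(ℂ, ℂ))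
          (fun z => TotalSpace.mk' ℂ (E := P) (mkM δ τ z, mkMhat δ τ μ) (s z)) ∧
        MDifferentiable 𝓘(ℂ, ℂ) ((𝓘(ℂ, ℂ).prod 𝓘(ℂ, ℂ)).prod 𝓘(ℂ, ℂ))
          (fun z => TotalSpace.mk' ℂ (E := P') (mkM δ τ z, mkMhat δ τ μ) (Ψ _ (s z))) := by
  obtain ⟨s, hs, h0, hm⟩ := h
  obtain ⟨s', hs', h0', hm'⟩ := h'
  have a0 : φ (s 0) ≠ 0 := fun hz => h0 0 (φ.map_eq_zero_iff.1 hz)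
  have a0' : φ' (s' 0) ≠ 0 := fun hz => h0' 0 (φ'.map_eq_zero_iff.1 hz)
  -- The scalar is the one for which `φ' ∘ Ψ 0` and `φ` agree on `s 0`, hence on the whole
  -- one-dimensional fibre.
  obtain ⟨Ψ, hΨ⟩ := exists_equiv_of_multipliers h0 h0' hm hm' (φ (s 0) / φ' (s' 0))
    (div_ne_zero a0 a0')
  refine ⟨Ψ, fun v => ?_, s, h0, mdifferentiable_of_pullback hs, ?_⟩
  · have hb := mem_baseSet_trivializationAt ℂ P (0, mkMhat δ τ μ)
    have hv := triv_div_smul (trivializationAt ℂ P (0, mkMhat δ τ μ)) hb (v := s 0) (h0 0) v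
    have hΨ0 : φ' (Ψ 0 (s 0)) = φ (s 0) := by
      have e : Ψ 0 (s 0) = (φ (s 0) / φ' (s' 0)) • s' 0 := hΨ 0
      rw [e]
      exact (φ'.map_smul _ _).trans (div_mul_cancel₀ _ a0')
    rw [← hv]
    have e1 : ∀ k : ℂ, Ψ 0 (k • s 0) = k • Ψ 0 (s 0) := fun k => (Ψ 0).map_smul k (s 0)
    have e2 := e1 ((trivializationAt ℂ P (0, mkMhat δ τ μ) ⟨(0, mkMhat δ τ μ), v⟩).2 /
      (trivializationAt ℂ P (0, mkMhat δ τ μ) ⟨(0, mkMhat δ τ μ), s 0⟩).2)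
    refine (congrArg φ' e2).trans ?_
    refine (φ'.map_smul _ _).trans ?_
    rw [hΨ0]
    exact (φ.map_smul _ _).symm
  · have h1 := mdifferentiable_smul_section (φ (s 0) / φ' (s' 0)) (mdifferentiable_of_pullback hs')
    refine fun w => (h1 w).congr_of_eventuallyEq (Filter.Eventually.of_forall fun z => ?_)
    exact congrArg (TotalSpace.mk' ℂ (E := P') (mkM δ τ z, mkMhat δ τ μ)) (hΨ z)

variable [ContMDiffVectorBundle 1 ℂ P (𝓘(ℂ, ℂ).prod 𝓘(ℂ, ℂ))]
  [ContMDiffVectorBundle 1 ℂ P' (𝓘(ℂ, ℂ).prod 𝓘(ℂ, ℂ))]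

/-- Two Poincaré line bundles are isomorphic. -/
theorem IsPoincareBundle.holIso (h : IsPoincareBundle δ τ P) (h' : IsPoincareBundle δ τ P') :
    HolIso (𝓘(ℂ, ℂ).prod 𝓘(ℂ, ℂ)) P P' := by
  obtain ⟨hm, φ, -, hφ⟩ := h
  obtain ⟨hm', φ', -, hφ'⟩ := h'
  have key : ∀ y : Mhat δ τ, ∃ Ψ : ∀ x, P (x, y) ≃ₗ[ℂ] P' (x, y),
      (∀ v : P (0, y), φ' y (Ψ 0 v) = φ y v) ∧ ∃ s : ∀ z, P (mkM δ τ z, y), (∀ z, s z ≠ 0) ∧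
        MDifferentiable 𝓘(ℂ, ℂ) ((𝓘(ℂ, ℂ).prod 𝓘(ℂ, ℂ)).prod 𝓘(ℂ, ℂ))
          (fun z => TotalSpace.mk' ℂ (E := P) (mkM δ τ z, y) (s z)) ∧
        MDifferentiable 𝓘(ℂ, ℂ) ((𝓘(ℂ, ℂ).prod 𝓘(ℂ, ℂ)).prod 𝓘(ℂ, ℂ))
          (fun z => TotalSpace.mk' ℂ (E := P') (mkM δ τ z, y) (Ψ _ (s z))) := by
    intro y
    obtain ⟨μ, rfl⟩ := QuotientAddGroup.mk_surjective y
    exact exists_slice_iso (hm μ) (hm' μ) (φ _) (φ' _)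
  choose Ψ₀ hΨ₀ hhol using key
  let Ψ : ∀ p, P p ≃ₗ[ℂ] P' p := fun p => Ψ₀ p.2 p.1
  have h1 : ∀ y : Mhat δ τ, HolAlong Ψ fun z => (QuotientAddGroup.mk z, y) := hhol
  have hone : MDifferentiable 𝓘(ℂ, ℂ) (𝓘(ℂ, ℂ).prod 𝓘(ℂ, ℂ))
      (fun μ : ℂ => (⟨mkMhat δ τ μ, (1 : ℂ)⟩ : TotalSpace ℂ (Bundle.Trivial (Mhat δ τ) ℂ))) :=
    fun μ => mdifferentiableAt_trivial_iff.2 ⟨mdifferentiable_mk μ, mdifferentiableAt_const⟩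
  -- By the normalization over the origin, `Ψ` carries the section of `P` with constant coordinate 1
  -- to that of `P'`; both are holomorphic.
  have h2 : HolAlong Ψ fun μ => (QuotientAddGroup.mk 0, QuotientAddGroup.mk μ) := by
    refine ⟨fun μ => (φ (mkMhat δ τ μ)).symm 1, fun μ hz => ?_, mdifferentiable_of_pullback (hφ.comp hone),
      fun w => (mdifferentiable_of_pullback (hφ'.comp hone) w).congr_of_eventuallyEq
        (Filter.Eventually.of_forall fun μ => ?_)⟩
    · exact one_ne_zero ((φ (mkMhat δ τ μ)).symm.map_eq_zero_iff.1 hz)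
    · refine congrArg (TotalSpace.mk' ℂ (E := P') (mkM δ τ 0, mkMhat δ τ μ)) ?_
      apply (φ' (mkMhat δ τ μ)).injective
      refine (hΨ₀ (mkMhat δ τ μ) _).trans ?_
      refine ((φ _).apply_symm_apply 1).trans ?_
      exact ((φ' (mkMhat δ τ μ)).apply_symm_apply 1).symm
  -- Holomorphy along a curve passes to the inverse isomorphism, so the slice criterion covers both
  -- directions.
  exact ⟨Ψ, mdifferentiable_of_slices (exists_lattice_close δ τ) Ψ h1 h2,
    mdifferentiable_of_slices (exists_lattice_close δ τ) _ (fun y => (h1 y).symm) h2.symm⟩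

end Uniqueness

/-! ### The gauge-theoretic bundle is a Poincaré bundle -/

section Gauge

variable {δ : ℕ+} {τ : ℍ}

/-- The lift of the global holomorphic frame of the pull-back of `(Id, Iso)^* 𝒫` to `V × V̄*` is
annihilated by the `(0,1)`-part of the connection. -/
theorem nabla_frameFun (u w : ℂ × ℂ) :
    zeroOnePart (nabla δ τ (frameFun δ τ 0 0) u) w = 0 := by
  -- The antilinear part of the derivative of the exponent cancels the antilinear part of the
  -- connection form, leaving a complex linear form.
  have key : ∀ w : ℂ × ℂ, nabla δ τ (frameFun δ τ 0 0) u w = frameFun δ τ 0 0 u *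
      (2 * Real.pi * Complex.I / τ.im * ((u.2.im : ℝ) * w.1 + (u.1.im : ℝ) * w.2)) := by
    intro w
    have h : Complex.I * (isoLift δ τ u.2 w.1 : ℝ) + 2 * Real.pi * Complex.I / τ.im *
        (u.2 * (w.1.im : ℝ)) = 2 * Real.pi * Complex.I / τ.im * ((u.2.im : ℝ) * w.1) := by
      rw [isoLift_apply]
      apply Complex.ext <;> simp
      ring
    rw [nabla, (hasFDerivAt_frameFun 0 0 u).fderiv]
    simp only [add_apply, smul_apply, smul_eq_mul, pullConnForm_apply, map_zero, zero_apply,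
      ContinuousLinearMap.comp_apply, ContinuousLinearMap.coe_fst', ContinuousLinearMap.coe_snd',
      Complex.ofRealCLM_apply, Complex.imCLM_apply, add_zero, mul_zero,
      zero_add]
    linear_combination (frameFun δ τ 0 0 u) * h
  rw [zeroOnePart_eq_zero, key, key]
  simp only [Prod.smul_fst, Prod.smul_snd, smul_eq_mul]
  ring

/-- The quotient of the global frame by a local holomorphic frame is holomorphic. -/
theorem differentiableAt_frameFun_div (e : HolFrame δ τ) {u : ℂ × ℂ} (hu : proj δ τ u ∈ e.U) :
    DifferentiableAt ℂ (fun v => frameFun δ τ 0 0 v / lift δ τ e.s v) u := by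
  have hO : IsOpen (proj δ τ ⁻¹' e.U) := e.isOpen_U.preimage (continuous_proj δ τ)
  have hne := lift_ne_zero (e.ne_zero _ hu)
  have hd := (hasFDerivAt_frameFun (δ := δ) (τ := τ) 0 0 u).differentiableAt.hasFDerivAt
  have hd' :=
    ((e.isHol.1.contDiffAt (hO.mem_nhds hu)).differentiableAt (by simp)).hasFDerivAt
  have hq : HasFDerivAt (fun v => frameFun δ τ 0 0 v * (lift δ τ e.s v)⁻¹) _ u :=
    hd.mul (((hasDerivAt_inv hne).complexToReal_fderiv).comp u hd')
  -- Both sections satisfy the same equation `∇^{0,1} = 0`; in the derivative of the quotient the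
  -- connection form cancels.
  have hlin : ∀ w, fderiv ℝ (fun v => frameFun δ τ 0 0 v * (lift δ τ e.s v)⁻¹) u (Complex.I • w) =
      Complex.I • fderiv ℝ (fun v => frameFun δ τ 0 0 v * (lift δ τ e.s v)⁻¹) u w := by
    intro w
    have h1 := zeroOnePart_eq_zero.1 (nabla_frameFun (δ := δ) (τ := τ) u w)
    have h2 := zeroOnePart_eq_zero.1 (e.isHol.2 u hu w)
    rw [hq.fderiv]
    simp only [nabla, add_apply, smul_apply, smul_eq_mul] at h1 h2 ⊢
    simp only [ContinuousLinearMap.comp_apply, smul_apply, one_apply_eq_self, smul_eq_mul]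
    field_simp
    linear_combination (lift δ τ e.s u) * h1 - (frameFun δ τ 0 0 u) * h2
  have hc := (DifferentiableAt.hasFDerivAt hq.differentiableAt)
  simp only [div_eq_mul_inv]
  set T := fderiv ℝ (fun v => frameFun δ τ 0 0 v * (lift δ τ e.s v)⁻¹) u
  have hcs : ∀ (c : ℂ) (v : ℂ × ℂ), T (c • v) = c • T v := by
    intro c v
    have : c • v = c.re • v + c.im • (Complex.I • v) := by
      rw [← Complex.coe_smul, ← Complex.coe_smul, smul_smul, ← add_smul, Complex.re_add_im]
    rw [this, map_add, map_smul, map_smul, hlin, ← Complex.coe_smul, ← Complex.coe_smul,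
      smul_smul, ← add_smul, Complex.re_add_im]
  let T' : ℂ × ℂ →L[ℂ] ℂ :=
    { toFun := T, map_add' := map_add T, map_smul' := hcs, cont := T.continuous }
  exact (hasFDerivAt_of_restrictScalars ℝ hc (show T'.restrictScalars ℝ = T from
    rfl)).differentiableAt

/-- The frame that defines the distinguished trivialization at `p`. -/
def frameAt (p : M δ τ × Mhat δ τ) : HolFrame δ τ := (exists_holFrame p).choose

theorem mem_frameAt (p : M δ τ × Mhat δ τ) : p ∈ (frameAt p).U := (exists_holFrame p).choose_spec

theorem trivializationAt_snd (p q : M δ τ × Mhat δ τ) (v : PullGauge δ τ q) :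
    (trivializationAt ℂ (PullGauge δ τ) p ⟨q, v⟩).2 = coord q v / coord q ((frameAt p).s q) := rfl

/-- The chosen representative behind `coord` may jump, but it changes numerator and denominator by
the same phase, so the representative `u.2` may be used instead. -/
theorem trivializationAt_proj (p : M δ τ × Mhat δ τ) (u : ℂ × ℂ)
    (v : PullGauge δ τ (proj δ τ u)) :
    (trivializationAt ℂ (PullGauge δ τ) p ⟨proj δ τ u, v⟩).2 =
      rep δ τ (proj δ τ u) u.2 rfl v / lift δ τ (frameAt p).s u := by
  have h := fun f => rep_change (p := proj δ τ u) (x := u.1) (μ := u.2) rfl rfl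
    (QuotientAddGroup.out_eq' _) f
  rw [trivializationAt_snd, coord, repEquiv_apply, repEquiv_apply, h, h,
    mul_div_mul_left _ _ (Complex.exp_ne_zero _)]
  rfl

theorem frameFun_zero (u : ℂ × ℂ) : frameFun δ τ 0 0 u =
    Complex.exp (2 * Real.pi * Complex.I / τ.im * (u.2 * (u.1.im : ℝ))) := by
  simp [frameFun]

theorem mk_eq_of_rep_eq {μ : ℂ} {x x' : M δ τ} (hx : x = x')
    {v : PullGauge δ τ (x, mkMhat δ τ μ)} {w : PullGauge δ τ (x', mkMhat δ τ μ)}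
    (h : rep δ τ (x, mkMhat δ τ μ) μ rfl v = rep δ τ (x', mkMhat δ τ μ) μ rfl w) :
    TotalSpace.mk' ℂ (E := sliceM δ τ (mkMhat δ τ μ) *ᵖ (PullGauge δ τ)) x v =
      TotalSpace.mk' ℂ x' w := by
  subst hx
  exact congrArg _ ((repEquiv (x, mkMhat δ τ μ) μ rfl).injective h)

/-- The restriction of `(Id, Iso)^* 𝒫` to `M × {[μ̂]}` is `P_μ̂`. -/
theorem hasMultipliers_pullGauge (μ : ℂ) :
    HasMultipliers (sliceM δ τ (mkMhat δ τ μ) *ᵖ (PullGauge δ τ)) (picMultiplier τ μ) := by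
  -- The entire factor corrects the global frame to `exp(-π μ z̄ / τ₂)`, since `2i Im z = z - z̄`.
  -- Translation by `l` multiplies this by `exp(-π μ l̄ / τ₂)`, the inverse of `picMultiplier τ μ l
  -- z`.
  let F : ℂ → ℂ := fun z => frameFun δ τ 0 0 (z, μ) * Complex.exp (-(Real.pi * μ * z / τ.im))
  let s : ∀ z, PullGauge δ τ (proj δ τ (z, μ)) := fun z =>
    (repEquiv (proj δ τ (z, μ)) μ rfl).symm (F z)
  have hs : ∀ z, rep δ τ (proj δ τ (z, μ)) μ rfl (s z) = F z := fun z =>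
    (repEquiv (proj δ τ (z, μ)) μ rfl).apply_symm_apply (F z)
  refine ⟨s, fun z => ?_, fun z hz => ?_, fun l hl z => ?_⟩
  · refine (mdifferentiableAt_pullback_iff _ _).2 ⟨mdifferentiable_mk z, ?_⟩
    have h1 : DifferentiableAt ℂ (fun w : ℂ => frameFun δ τ 0 0 (w, μ) /
        lift δ τ (frameAt (proj δ τ (z, μ))).s (w, μ)) z :=
      DifferentiableAt.comp (f := fun w : ℂ => (w, μ)) z
        (differentiableAt_frameFun_div (frameAt (proj δ τ (z, μ))) (mem_frameAt _))
        (differentiableAt_id.prodMk (differentiableAt_const μ))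
    have h2 : DifferentiableAt ℂ (fun w : ℂ => Complex.exp (-(Real.pi * μ * w / τ.im))) z := by
      fun_prop
    refine (h1.mul h2).mdifferentiableAt.congr_of_eventuallyEq (Filter.Eventually.of_forall
      fun w => ?_)
    refine (trivializationAt_proj (proj δ τ (z, μ)) (w, μ) (s w)).trans ?_
    rw [hs]
    simp only [F, Pi.mul_apply]
    ring
  · have h1 : F z = 0 := (repEquiv (proj δ τ (z, μ)) μ rfl).symm.map_eq_zero_iff.1 hz
    simp only [F, frameFun_zero] at h1
    exact mul_ne_zero (Complex.exp_ne_zero _) (Complex.exp_ne_zero _) h1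
  · refine mk_eq_of_rep_eq (QuotientAddGroup.eq.2 (by rwa [neg_add_cancel_left])).symm ?_
    have e : rep δ τ (proj δ τ (z, μ)) μ rfl ((picMultiplier τ μ l z)⁻¹ • s z) =
        (picMultiplier τ μ l z)⁻¹ * F z := by
      rw [← hs]
      rfl
    refine (hs (z + l)).trans (Eq.trans ?_ e.symm)
    simp only [F, frameFun_zero, picMultiplier, eStar]
    rw [← Complex.exp_neg, ← Complex.exp_add, ← Complex.exp_add, ← Complex.exp_add]
    congr 1
    have him : (τ.im : ℂ) ≠ 0 := Complex.ofReal_ne_zero.2 τ.im_ne_zero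
    have h1 : ((l.im : ℝ) : ℂ) * (2 * Complex.I) = l - (starRingEnd ℂ) l := by
      rw [Complex.sub_conj]
      push_cast
      ring
    have hI := Complex.I_mul_I
    rw [Complex.add_im]
    push_cast
    field_simp
    linear_combination μ * h1 - μ * (starRingEnd ℂ) l * hI

/-- The coordinate over `{0} × M̂` of the distinguished frame at `(0, y)` is holomorphic near `y`. -/
theorem mdifferentiableAt_coord_frame (y : Mhat δ τ) :
    MDifferentiableAt 𝓘(ℂ, ℂ) 𝓘(ℂ, ℂ)
      (fun y' : Mhat δ τ => (coord (0, y') ((frameAt (0, y)).s (0, y')) : ℂ)) y := by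
  obtain ⟨μ, rfl⟩ := QuotientAddGroup.mk_surjective y
  refine mdifferentiableAt_of_lift_one ?_
  set e := frameAt ((0 : M δ τ), mkMhat δ τ μ)
  have hu : proj δ τ (0, μ) ∈ e.U := mem_frameAt ((0 : M δ τ), mkMhat δ τ μ)
  have h1 : DifferentiableAt ℂ (fun w : ℂ => frameFun δ τ 0 0 (0, w) / lift δ τ e.s (0, w)) μ :=
    DifferentiableAt.comp (f := fun w : ℂ => ((0 : ℂ), w)) μ
      (differentiableAt_frameFun_div e hu) ((differentiableAt_const 0).prodMk differentiableAt_id)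
  have h0 : ∀ w : ℂ, frameFun δ τ 0 0 (0, w) = 1 := fun w => by simp [frameFun_zero]
  have hne : frameFun δ τ 0 0 (0, μ) / lift δ τ e.s (0, μ) ≠ 0 := by
    rw [h0]
    exact one_div_ne_zero (lift_ne_zero (e.ne_zero _ hu))
  -- Over `x = 0` the global frame is 1, so the inverse of the holomorphic quotient is the lift of
  -- the local frame itself.
  refine (h1.inv hne).congr_of_eventuallyEq (Filter.Eventually.of_forall fun w => ?_)
  have h := rep_change (p := proj δ τ (0, w)) (x := 0) (μ := w) rfl rfl
    (QuotientAddGroup.out_eq' _) (e.s (proj δ τ (0, w)))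
  rw [map_zero, Complex.ofReal_zero, mul_zero, Complex.exp_zero, one_mul] at h
  simp only [Pi.inv_apply, h0, one_div, inv_inv]
  exact h

theorem coord_frame_ne_zero (y : Mhat δ τ) :
    coord ((0 : M δ τ), y) ((frameAt (0, y)).s (0, y)) ≠ 0 := fun h =>
  (frameAt (0, y)).ne_zero _ (mem_frameAt _) ((coord (0, y)).map_eq_zero_iff.1 h)

theorem eventually_coord_frame_ne_zero (y : Mhat δ τ) :
    ∀ᶠ y' in 𝓝 y, coord ((0 : M δ τ), y') ((frameAt (0, y)).s (0, y')) ≠ 0 :=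
  (mdifferentiableAt_coord_frame y).continuousAt.eventually_ne (coord_frame_ne_zero y)

/-- The restriction of `(Id, Iso)^* 𝒫` to `{0} × M̂` is trivial. -/
theorem holIso_trivial_pullGauge :
    HolIso 𝓘(ℂ, ℂ) (sliceMhat δ τ 0 *ᵖ (PullGauge δ τ)) (Bundle.Trivial (Mhat δ τ) ℂ) := by
  -- At `x = 0` all phases `exp(-2πi⟨ν, x⟩)` are 1, so `coord` does not depend on the chosen
  -- representative and is a global trivialization there.
  refine ⟨fun y => coord ((0 : M δ τ), y), fun v => ?_, fun v => ?_⟩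
  · have h1 := (mdifferentiableAt_pullback_iff (sliceMhat δ τ 0) id).1 (mdifferentiableAt_id (x := v))
    have h2 := (mdifferentiableAt_coord_frame v.1).comp v h1.1
    refine mdifferentiableAt_trivial_iff.2 ⟨h1.1, ?_⟩
    refine (h1.2.mul h2).congr_of_eventuallyEq ?_
    filter_upwards [h1.1.continuousAt.eventually (eventually_coord_frame_ne_zero v.1)] with w hw
    exact (div_mul_cancel₀ _ hw).symm
  · have h1 := mdifferentiableAt_trivial_iff.1 (mdifferentiableAt_id (I := 𝓘(ℂ, ℂ).prod 𝓘(ℂ, ℂ))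
      (x := v))
    have h2 := (mdifferentiableAt_coord_frame v.1).comp v h1.1
    refine (mdifferentiableAt_pullback_iff _ _).2 ⟨h1.1, ?_⟩
    have h3 := (differentiableAt_inv (coord_frame_ne_zero v.1)).mdifferentiableAt.comp v h2
    refine (h1.2.mul h3).congr_of_eventuallyEq (Filter.Eventually.of_forall fun w => ?_)
    refine (trivializationAt_snd ((0 : M δ τ), v.1) (0, w.1) _).trans ?_
    exact (congrArg (· / _) ((coord ((0 : M δ τ), w.1)).apply_symm_apply w.2)).trans
      (div_eq_mul_inv _ _)

theorem isPoincareBundle_pullGauge (δ : ℕ+) (τ : ℍ) : IsPoincareBundle δ τ (PullGauge δ τ) :=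
  ⟨hasMultipliers_pullGauge, holIso_trivial_pullGauge⟩

end Gauge

end CTorus

end

theorem mainTheorem5 (δ : ℕ+) (τ : UpperHalfPlane) :
    CTorus.IsPoincareBundle δ τ (CTorus.PullGauge δ τ) ∧
    ∀ (P : CTorus.M δ τ × CTorus.Mhat δ τ → Type*)
      [∀ p, AddCommGroup (P p)] [∀ p, Module ℂ (P p)]
      [TopologicalSpace (Bundle.TotalSpace ℂ P)] [∀ p, TopologicalSpace (P p)]
      [FiberBundle ℂ P] [VectorBundle ℂ ℂ P]
      [ContMDiffVectorBundle ∞ ℂ P (𝓘(ℂ, ℂ).prod 𝓘(ℂ, ℂ))],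
      CTorus.IsPoincareBundle δ τ P →
        CTorus.HolIso (𝓘(ℂ, ℂ).prod 𝓘(ℂ, ℂ)) P (CTorus.PullGauge δ τ) := by
  refine ⟨CTorus.isPoincareBundle_pullGauge δ τ, ?_⟩
  intro P _ _ _ _ _ _ _ hP
  -- Uniqueness uses only one complex derivative of the transition functions.
  have : ContMDiffVectorBundle 1 ℂ P (𝓘(ℂ, ℂ).prod 𝓘(ℂ, ℂ)) := .of_le (n := ∞) (by simp)
  have : ContMDiffVectorBundle 1 ℂ (CTorus.PullGauge δ τ) (𝓘(ℂ, ℂ).prod 𝓘(ℂ, ℂ)) :=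
    .of_le (n := ∞) (by simp)
  exact hP.holIso (CTorus.isPoincareBundle_pullGauge δ τ)
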